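/- A $3$-uniform hypergraph $H=(V,E)$ consists of a finite vertex set $V$ and a set $E$ of $3$-element subsets of $V$. The Fano plane is the (unique) linear $3$-uniform hypergraph with seven vertices and seven hyperedges (linear: any two distinct hyperedges share at most one vertex). $H$ is Fano-free if it has no (not necessarily induced) subhypergraph isomorphic to the Fano plane, and $\mathrm{ex}(n,\mathrm{Fano})$ is the maximum number of hyperedges of a Fano-free $3$-uniform hypergraph on $n$ vertices. For $A\subseteq V$ let $e_H(A)$ be the number of hyperedges of $H$ contained in $A$. **Theorem.** For every fixed real $\delta$ with $0<\delta<(1/36)^8$ there exists $n_0$ such that the following holds for all $n\ge n_0$. If $H=(V,E)$ is a Fano-free $3$-uniform hypergraph on $n$ vertices with at least $\mathrm{ex}(n,\mathrm{Fano})-\delta n^3/8$ hyperedges, then there is a partition $V=A\cup B$ (with $A\cap B=\emptyset$) such that $$e_H(A)+e_H(B)\;\le\;\frac{9}{16}\,\bigl(3^2\cdot 2^4\cdot 139\bigr)^{1/8}\,\delta^{1/64}\,n^3\;<\;1.94\,\delta^{1/64}\,n^3 .$$ -/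

import Mathlib

/-- An `r`-uniform hypergraph with vertex set `V`: a finite set of hyperedges, each of which is
a set of exactly `r` vertices. -/
structure UniformHypergraph (r : ℕ) (V : Type*) where
  edges : Finset (Finset V)
  uniform : ∀ e ∈ edges, e.card = r

namespace UniformHypergraph

/-- `H` contains a (not necessarily induced) copy of `F` as a subhypergraph. -/
def Contains {r : ℕ} {V W : Type*} (H : UniformHypergraph r V) (F : UniformHypergraph r W) :
    Prop :=
  ∃ f : W ↪ V, ∀ e ∈ F.edges, e.map f ∈ H.edges

/-- `H` is `F`-free. -/
def Free {r : ℕ} {V W : Type*} (H : UniformHypergraph r V) (F : UniformHypergraph r W) : Prop :=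
  ¬ H.Contains F

/-- The Turán number `ex(n, F)`: the maximum number of hyperedges of an `F`-free `r`-uniform
hypergraph on `n` vertices. -/
noncomputable def ex {r : ℕ} {W : Type*} (n : ℕ) (F : UniformHypergraph r W) : ℕ :=
  sSup {m : ℕ | ∃ H : UniformHypergraph r (Fin n), H.Free F ∧ H.edges.card = m}

/-- `e_H(A)`: the number of hyperedges of `H` contained in `A`. -/
def edgesIn {r : ℕ} {V : Type*} [DecidableEq V] (H : UniformHypergraph r V) (A : Finset V) : ℕ :=
  (H.edges.filter (fun e => e ⊆ A)).card

set_option maxRecDepth 10000 in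
/-- The Fano plane, with points `0, …, 6` and lines `{i, i + 1, i + 3}` modulo `7`. -/
def fano : UniformHypergraph 3 (Fin 7) where
  edges := {{0, 1, 3}, {1, 2, 4}, {2, 3, 5}, {3, 4, 6}, {4, 5, 0}, {5, 6, 1}, {6, 0, 2}}
  uniform := by decide

set_option maxRecDepth 10000 in
/-- The Fano plane has seven hyperedges, and any two of them share at most one vertex. -/
theorem fano_linear : fano.edges.card = 7 ∧
    ∀ e ∈ fano.edges, ∀ f ∈ fano.edges, e ≠ f → (e ∩ f).card ≤ 1 := by
  decide

end UniformHypergraph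

/-! The only structural input is that the Fano plane consists of one line `xyz` and six lines
through the remaining four points: the three perfect matchings of those points, one assigned to each
of `x`, `y`, `z`. So a hyperedge `xyz` cannot coexist with four further vertices whose three
matchings lie in the links of `x`, `y`, `z` respectively (`Free.no_fano_triples`).

Counting ordered triples, the balanced bipartite construction has density `3/4`, and every link in
it has density about `3/4`. A near-extremal Fano-free hypergraph loses few vertices on passing to a
set `U` where all links have density close to `3/4` (`Free.exists_large_minDegree`). Density above
`2/3` yields a tetrahedron. Its four links colour the pairs of `U` with up to four colours each, no
four vertices have a rainbow triple of matchings, and the average number of colours is nearly the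
maximum 3. Stability for such colourings (`RainbowFree.exists_parts_of_minDegree`) gives two parts
of size about `|U|/2` such that each link avoids all pairs inside one of them (`Free.exists_parts`).

Let `p` be one vertex of the tetrahedron and `B` the part its link avoids. A typical vertex `x` has
a link that either nearly contains the link of `p` or nearly contains all pairs inside `B`
(`Free.link_dichotomy`). Three vertices of the same kind have a common link of density above `2/3`
in `U`, respectively in `B`; Turán's theorem puts a `K₄` there, so the three cannot form a
hyperedge. Both kinds are therefore independent, and only hyperedges meeting the few remaining
vertices can spoil the bipartition (`Free.stability`). -/

open Finset

/-! ### Counting ordered pairs, and Turán's theorem in that form -/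

section PairCount

variable {V : Type*}

open Classical in
/-- The number of ordered pairs of elements of `U` satisfying `P`. -/
noncomputable def pairCount (U : Finset V) (P : V → V → Prop) : ℝ :=
  #{p ∈ U ×ˢ U | P p.1 p.2}

open Classical in
theorem pairCount_eq_sum (U : Finset V) (P : V → V → Prop) :
    pairCount U P = ∑ y ∈ U, ∑ z ∈ U, if P y z then (1 : ℝ) else 0 := by
  rw [pairCount, Finset.card_filter, Finset.sum_product]
  push_cast
  rfl

theorem pairCount_le_add {U : Finset V} {P Q R : V → V → Prop}
    (h : ∀ y ∈ U, ∀ z ∈ U, P y z → Q y z ∨ R y z) :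
    pairCount U P ≤ pairCount U Q + pairCount U R := by
  classical
  simp only [pairCount_eq_sum, ← Finset.sum_add_distrib]
  refine Finset.sum_le_sum fun y hy => Finset.sum_le_sum fun z hz => ?_
  have := h y hy z hz
  by_cases h1 : P y z <;> by_cases h2 : Q y z <;> by_cases h3 : R y z <;> simp_all

theorem pairCount_add_le {U : Finset V} {P Q R : V → V → Prop}
    (hP : ∀ y ∈ U, ∀ z ∈ U, P y z → R y z) (hQ : ∀ y ∈ U, ∀ z ∈ U, Q y z → R y z)
    (hPQ : ∀ y ∈ U, ∀ z ∈ U, P y z → ¬ Q y z) :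
    pairCount U P + pairCount U Q ≤ pairCount U R := by
  classical
  simp only [pairCount_eq_sum, ← Finset.sum_add_distrib]
  refine Finset.sum_le_sum fun y hy => Finset.sum_le_sum fun z hz => ?_
  have h1 := hP y hy z hz
  have h2 := hQ y hy z hz
  have h3 := hPQ y hy z hz
  by_cases h1 : P y z <;> by_cases h2 : Q y z <;> by_cases h3 : R y z <;> simp_all

theorem pairCount_mono {U : Finset V} {P Q : V → V → Prop}
    (h : ∀ y ∈ U, ∀ z ∈ U, P y z → Q y z) : pairCount U P ≤ pairCount U Q := by
  have h0 : pairCount U (fun _ _ => False) = 0 := by simp [pairCount]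
  have := pairCount_le_add (R := fun _ _ => False) (fun y hy z hz hP => Or.inl (h y hy z hz hP))
  linarith

theorem pairCount_mem_mem {U S S' : Finset V} (hS : S ⊆ U) (hS' : S' ⊆ U) :
    pairCount U (fun y z => y ∈ S ∧ z ∈ S') = (#S : ℝ) * #S' := by
  classical
  rw [pairCount, ← Nat.cast_mul, ← Finset.card_product]
  congr 2
  ext p
  simp only [mem_filter, mem_product]
  exact ⟨fun h => h.2, fun h => ⟨⟨hS h.1, hS' h.2⟩, h⟩⟩

theorem pairCount_true (U : Finset V) : pairCount U (fun _ _ => True) = (#U : ℝ) ^ 2 := by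
  simp [pairCount, sq]

/-- Turán's theorem for ordered pairs: a symmetric irreflexive relation satisfied by more than
`(1 - 1 / r) * #U ^ 2` ordered pairs has a clique of size `r + 1`. -/
theorem exists_clique_of_pairCount {U : Finset V} {G : V → V → Prop} (hs : ∀ x y, G x y → G y x)
    (hi : ∀ x, ¬ G x x) {r : ℕ} (hr : 0 < r)
    (h : ((r : ℝ) - 1) * (#U : ℝ) ^ 2 < r * pairCount U G) :
    ∃ f : Fin (r + 1) → V, (∀ i, f i ∈ U) ∧ ∀ i j, i ≠ j → G (f i) (f j) := by
  classical
  let K : SimpleGraph U :=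
    { Adj := fun x y => G x y, symm := ⟨fun x y => hs x y⟩, loopless := ⟨fun x => hi x⟩ }
  by_cases cf : K.CliqueFree (r + 1)
  · exfalso
    obtain ⟨M, _, maxM⟩ := SimpleGraph.exists_isTuranMaximal (V := U) hr
    have h1 : #K.edgeFinset ≤ #M.edgeFinset := by convert maxM.2 cf
    rw [((SimpleGraph.isTuranMaximal_iff_nonempty_iso_turanGraph hr).mp maxM).some.card_edgeFinset_eq]
      at h1
    have h2 := SimpleGraph.mul_card_edgeFinset_turanGraph_le (n := Fintype.card U) (r := r)
    have h3 : pairCount U G = 2 * (#K.edgeFinset : ℝ) := by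
      have := K.sum_degrees_eq_twice_card_edges
      have h4 : (∑ v, (K.degree v : ℝ)) = 2 * (#K.edgeFinset : ℝ) := by exact_mod_cast this
      rw [← h4, pairCount_eq_sum, ← Finset.sum_coe_sort]
      refine Finset.sum_congr rfl fun v _ => ?_
      rw [← Finset.sum_coe_sort, ← SimpleGraph.card_neighborFinset_eq_degree,
        SimpleGraph.neighborFinset_eq_filter, Finset.card_filter]
      push_cast
      rfl
    have h5 : 2 * r * #K.edgeFinset ≤ (r - 1) * (#U) ^ 2 := by
      have := (Nat.mul_le_mul_left (2 * r) h1).trans h2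
      rwa [Fintype.card_coe] at this
    have h6 : (2 * r * #K.edgeFinset : ℝ) ≤ ((r : ℝ) - 1) * (#U : ℝ) ^ 2 := by
      have : ((2 * r * #K.edgeFinset : ℕ) : ℝ) ≤ (((r - 1) * (#U) ^ 2 : ℕ) : ℝ) := by
        exact_mod_cast h5
      push_cast [Nat.cast_sub hr] at this
      exact this
    rw [h3] at h
    linarith
  · rw [SimpleGraph.not_cliqueFree_iff_top_isContained] at cf
    obtain ⟨f⟩ := cf
    refine ⟨fun i => (f i : V), fun i => (f i).2, fun i j hij => ?_⟩
    exact f.toHom.map_adj (show (⊤ : SimpleGraph (Fin (r + 1))).Adj i j from hij)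

theorem pairCount_subset {U S : Finset V} (hS : S ⊆ U) (P : V → V → Prop) :
    pairCount U (fun y z => (y ∈ S ∧ z ∈ S) ∧ P y z) = pairCount S P := by
  classical
  rw [pairCount, pairCount]
  congr 2
  ext p
  simp only [mem_filter, mem_product]
  exact ⟨fun h => h.2, fun h => ⟨⟨hS h.1.1, hS h.1.2⟩, h⟩⟩

open Classical in
theorem pairCount_eq_sum_card (U : Finset V) (P : V → V → Prop) :
    pairCount U P = ∑ x ∈ U, (#{y ∈ U | P x y} : ℝ) := by
  rw [pairCount_eq_sum]
  refine Finset.sum_congr rfl fun x _ => ?_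
  rw [Finset.card_filter]
  push_cast
  rfl

end PairCount

/-! ### Stability of rainbow-free colourings of pairs -/

section Rainbow

variable {V : Type*}

/-- A symmetric assignment of sets of at most four colours to pairs of vertices, empty on the
diagonal, for which no four vertices have their three perfect matchings in distinct colours. -/
structure RainbowFree (C : V → V → Finset (Fin 4)) : Prop where
  symm : ∀ x y, C x y = C y x
  irrefl : ∀ x, C x x = ∅
  free : ∀ a b c d, ∀ i ∈ C a b ∩ C c d, ∀ j ∈ C a c ∩ C b d, ∀ k ∈ C a d ∩ C b c,
    i ≠ j → i ≠ k → j ≠ k → False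

theorem exists_distinct_representatives {α : Type*} [DecidableEq α] {X Y Z : Finset α}
    (hX : 1 ≤ #X) (hY : 2 ≤ #Y) (hZ : 3 ≤ #Z) :
    ∃ i ∈ X, ∃ j ∈ Y, ∃ k ∈ Z, i ≠ j ∧ i ≠ k ∧ j ≠ k := by
  obtain ⟨i, hi⟩ := Finset.card_pos.1 hX
  obtain ⟨j, hj, hij⟩ := Finset.exists_mem_ne (s := Y) (by omega) i
  have : 0 < #(Z \ {i, j}) := by
    have h1 := Finset.le_card_sdiff {i, j} Z
    have h2 : #({i, j} : Finset α) ≤ 2 := Finset.card_le_two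
    omega
  obtain ⟨k, hk⟩ := Finset.card_pos.1 this
  simp only [mem_sdiff, mem_insert, mem_singleton, not_or] at hk
  exact ⟨i, hi, j, hj, k, hk.1, hij.symm, Ne.symm hk.2.1, Ne.symm hk.2.2⟩

theorem card_add_card_le_inter (X Y : Finset (Fin 4)) : #X + #Y ≤ #(X ∩ Y) + 4 := by
  have h1 := Finset.card_inter_add_card_union X Y
  have h2 : #(X ∪ Y) ≤ 4 := by simpa using Finset.card_le_univ (X ∪ Y)
  omega

theorem card_colours_le (X : Finset (Fin 4)) : #X ≤ 4 := by simpa using Finset.card_le_univ X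

theorem inter_card_of_full {X Y : Finset (Fin 4)} (h : #X = 4) : #(X ∩ Y) = #Y := by
  have : X = univ := by
    rw [← Finset.card_eq_iff_eq_univ]
    simpa using h
  simp [this]

-- Hall's condition: three sets that each omit at most two of four colours fail to have distinct
-- representatives only if all three are the same two-element set.
set_option synthInstance.maxSize 2000 in
set_option synthInstance.maxHeartbeats 400000 in
theorem missing_colours : ∀ p p' q q' r r' : Fin 4,
    (∀ i j k : Fin 4, i ≠ p ∧ i ≠ p' → j ≠ q ∧ j ≠ q' → k ≠ r ∧ k ≠ r' →
      i = j ∨ i = k ∨ j = k) →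
    p ≠ p' ∧ (q = p ∧ q' = p' ∨ q = p' ∧ q' = p) ∧ (r = p ∧ r' = p' ∨ r = p' ∧ r' = p) := by
  decide +kernel

namespace RainbowFree

variable {C : V → V → Finset (Fin 4)}

/-- Sets of sizes at least 1, 2, 3 have distinct representatives by greedy choice, so no ordering of
the three matchings may reach these sizes. Later arguments use rainbow-freeness mostly through these
inequalities and `omega`. -/
theorem card_matchings (h : RainbowFree C) (a b c d : V) :
    let p := #(C a b ∩ C c d)
    let q := #(C a c ∩ C b d)
    let r := #(C a d ∩ C b c)
    ¬ (1 ≤ p ∧ 2 ≤ q ∧ 3 ≤ r) ∧ ¬ (1 ≤ p ∧ 2 ≤ r ∧ 3 ≤ q) ∧ ¬ (1 ≤ q ∧ 2 ≤ p ∧ 3 ≤ r) ∧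
      ¬ (1 ≤ q ∧ 2 ≤ r ∧ 3 ≤ p) ∧ ¬ (1 ≤ r ∧ 2 ≤ p ∧ 3 ≤ q) ∧ ¬ (1 ≤ r ∧ 2 ≤ q ∧ 3 ≤ p) := by
  have hf := h.free a b c d
  refine ⟨?_, ?_, ?_, ?_, ?_, ?_⟩ <;> rintro ⟨h1, h2, h3⟩ <;>
    obtain ⟨i, hi, j, hj, k, hk, hij, hik, hjk⟩ := exists_distinct_representatives h1 h2 h3
  · exact hf i hi j hj k hk hij hik hjk
  · exact hf i hi k hk j hj hik hij hjk.symm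
  · exact hf j hj i hi k hk hij.symm hjk hik
  · exact hf k hk i hi j hj hik.symm hjk.symm hij
  · exact hf j hj k hk i hi hjk hij.symm hik.symm
  · exact hf k hk j hj i hi hjk.symm hik.symm hij.symm

/-- If `xz` and `yz` are full and `xy` has at least three colours, then the star of any vertex `t`
to `x, y, z` is small. -/
theorem star_le (h : RainbowFree C) {x y z : V} (hxz : #(C x z) = 4) (hyz : #(C y z) = 4)
    (hxy : 3 ≤ #(C x y)) (t : V) : 2 * #(C x t) + 2 * #(C y t) + 3 * #(C z t) ≤ 20 := by
  have h1 := h.card_matchings x y z t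
  simp only [inter_card_of_full hxz, Finset.inter_comm (C x t), inter_card_of_full hyz] at h1
  have h2 := card_add_card_le_inter (C x y) (C z t)
  have h3 := card_colours_le (C x t)
  have h4 := card_colours_le (C y t)
  have h5 := card_colours_le (C z t)
  omega

/-- The number of coloured pairs at `x` with the other end in `W`, with multiplicity. -/
def colourDeg (C : V → V → Finset (Fin 4)) (W : Finset V) (x : V) : ℝ :=
  ∑ y ∈ W, (#(C x y) : ℝ)

/-- The weights 2, 2, 3 in `star_le` add up to 7, so degrees near `3 * #W` would give a weighted
total near `21 * #W`, above the permitted `20 * #W`. This is the source of the threshold `1 / 7`. -/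
theorem no_heavy_triangle (h : RainbowFree C) {W : Finset V} (hW : W.Nonempty) {γ : ℝ}
    (hγ : γ < 1 / 7) (hd : ∀ x ∈ W, (3 - γ) * #W ≤ colourDeg C W x) {x y z : V} (hx : x ∈ W)
    (hy : y ∈ W) (hz : z ∈ W) (hxz : #(C x z) = 4) (hyz : #(C y z) = 4) : #(C x y) ≤ 2 := by
  by_contra! hxy
  have h1 : 2 * colourDeg C W x + 2 * colourDeg C W y + 3 * colourDeg C W z ≤ 20 * #W := by
    simp only [colourDeg, Finset.mul_sum, ← Finset.sum_add_distrib]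
    calc _ ≤ ∑ _t ∈ W, (20 : ℝ) := Finset.sum_le_sum fun t _ => by
          exact_mod_cast h.star_le hxz hyz hxy t
      _ = 20 * #W := by simp [mul_comm]
  have h2 := hd x hx
  have h3 := hd y hy
  have h4 := hd z hz
  have h5 : (0 : ℝ) < #W := by exact_mod_cast hW.card_pos
  nlinarith

theorem add_le_six (h : RainbowFree C) {W : Finset V} (hW : W.Nonempty) {γ : ℝ}
    (hγ : γ < 1 / 7) (hd : ∀ x ∈ W, (3 - γ) * #W ≤ colourDeg C W x) {x y z : V} (hx : x ∈ W)
    (hy : y ∈ W) (hz : z ∈ W) (hxy : #(C x y) = 4) :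
    #(C x z) + #(C y z) ≤ 6 := by
  have h1 := h.no_heavy_triangle hW hγ hd (x := z) (y := y) (z := x) hz hy hx
  have h2 := h.no_heavy_triangle hW hγ hd (x := z) (y := x) (z := y) hz hx hy
  rw [h.symm z x, h.symm z y, h.symm y x] at h1
  rw [h.symm z x, h.symm z y] at h2
  have h3 := card_colours_le (C x z)
  have h4 := card_colours_le (C y z)
  have h5 : #(C x z) = 4 → #(C y z) ≤ 2 := fun hh => h1 hh hxy
  have h6 : #(C y z) = 4 → #(C x z) ≤ 2 := fun hh => h2 hh hxy
  omega

/-- Without a full pair every pair has at most 3 colours. With a full pair `xy`, `add_le_six` bounds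
the degrees of `x` and `y` by 3 on average. -/
theorem exists_colourDeg_le (h : RainbowFree C) {W : Finset V} (hW : W.Nonempty) :
    ∃ x ∈ W, colourDeg C W x ≤ 3 * #W := by
  by_contra! hd
  have hd' : ∀ x ∈ W, (3 - 0) * #W ≤ colourDeg C W x := fun x hx => by
    simpa using (hd x hx).le
  by_cases hfull : ∃ x ∈ W, ∃ y ∈ W, #(C x y) = 4
  · obtain ⟨x, hx, y, hy, hxy⟩ := hfull
    have h1 : colourDeg C W x + colourDeg C W y ≤ 6 * #W := by
      simp only [colourDeg, ← Finset.sum_add_distrib]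
      calc _ ≤ ∑ _t ∈ W, (6 : ℝ) := Finset.sum_le_sum fun t ht => by
            exact_mod_cast h.add_le_six hW (by norm_num) hd' hx hy ht hxy
        _ = 6 * #W := by simp [mul_comm]
    linarith [hd x hx, hd y hy]
  · push Not at hfull
    obtain ⟨x, hx⟩ := hW
    have h1 : colourDeg C W x ≤ 3 * #W := by
      simp only [colourDeg]
      calc _ ≤ ∑ _t ∈ W, (3 : ℝ) := Finset.sum_le_sum fun t ht => by
            have h2 := hfull x hx t ht
            have h3 := card_colours_le (C x t)
            exact_mod_cast (show #(C x t) ≤ 3 by omega)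
        _ = 3 * #W := by simp [mul_comm]
    linarith [hd x hx]

/-- The number of coloured ordered pairs of elements of `W`, with multiplicity. -/
def colourVol (C : V → V → Finset (Fin 4)) (W : Finset V) : ℝ := ∑ x ∈ W, colourDeg C W x

theorem colourVol_erase [DecidableEq V] (h : RainbowFree C) {W : Finset V} {x : V} (hx : x ∈ W) :
    colourVol C W = colourVol C (W.erase x) + 2 * colourDeg C W x := by
  have h0 : #(C x x) = 0 := by simp [h.irrefl]
  have h1 : ∀ y, colourDeg C W y = #(C x y) + colourDeg C (W.erase x) y := fun y => by
    rw [colourDeg, ← Finset.add_sum_erase W _ hx, h.symm y x]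
    rfl
  rw [colourVol, ← Finset.add_sum_erase W _ hx, Finset.sum_congr rfl fun y _ => h1 y,
    Finset.sum_add_distrib]
  change _ + (colourDeg C (W.erase x) x + colourVol C (W.erase x)) = _
  rw [h1 x, h0]
  push_cast
  ring

theorem colourVol_le (h : RainbowFree C) (W : Finset V) :
    colourVol C W ≤ 3 * (#W : ℝ) ^ 2 + 3 * #W := by
  classical
  induction hn : #W generalizing W with
  | zero =>
    rw [Finset.card_eq_zero] at hn
    simp [hn, colourVol]
  | succ n ih =>
    obtain ⟨x, hx, hdx⟩ := h.exists_colourDeg_le (W := W) (Finset.card_pos.1 (by omega))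
    have h1 := ih (W.erase x) (by rw [Finset.card_erase_of_mem hx]; omega)
    -- The induction is exact: `3 n ^ 2 + 3 n` grows by `6 (n + 1)`, twice the permitted degree.
    rw [h.colourVol_erase hx]
    rw [hn] at hdx
    push_cast at hdx ⊢
    nlinarith

/-- A subset with large minimum colour degree, obtained by optimising. -/
theorem exists_large_minDegree (h : RainbowFree C) (U : Finset V) {η : ℝ} (hη : 0 < η)
    (hη1 : η ≤ 1 / 4) (hm : 6 / η ^ 2 ≤ #U) (hU : (3 - η ^ 2) * (#U : ℝ) ^ 2 ≤ colourVol C U) :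
    ∃ W ⊆ U, W.Nonempty ∧ (1 - 2 * η) * #U ≤ #W ∧
      ∀ x ∈ W, (3 - 2 * η) * #W ≤ colourDeg C W x := by
  classical
  -- Comparing the maximiser with `U` shows that it is large; comparing it with itself minus one
  -- vertex bounds the degree of that vertex from below.
  obtain ⟨W, hWU, hmax⟩ := Finset.exists_max_image U.powerset
    (fun W => colourVol C W - (3 - η) * (#W : ℝ) ^ 2) ⟨U, by simp⟩
  rw [Finset.mem_powerset] at hWU
  have h1 := hmax U (by simp)
  have h2 := h.colourVol_le W
  have hcard : (#W : ℝ) ≤ #U := by exact_mod_cast Finset.card_le_card hWU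
  have hm' : 6 ≤ #U * η ^ 2 := by rwa [div_le_iff₀ (by positivity)] at hm
  have hWn : (0 : ℝ) ≤ #W := Nat.cast_nonneg _
  have hUn : (0 : ℝ) ≤ #U := Nat.cast_nonneg _
  have hbig : (1 - 2 * η) * #U ≤ #W := by
    by_contra! hlt
    have h3 : η * (#W : ℝ) ^ 2 + 3 * #W ≥ (η - η ^ 2) * (#U : ℝ) ^ 2 := by
      nlinarith
    have h4 : (#W : ℝ) ^ 2 ≤ (1 - 2 * η) * (#U : ℝ) ^ 2 := by nlinarith
    have h5 : η * (#W : ℝ) ^ 2 ≤ η * ((1 - 2 * η) * (#U : ℝ) ^ 2) := by gcongr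
    have h6 : 6 * (#U : ℝ) ≤ #U * η ^ 2 * #U := by gcongr
    have hUpos : (0 : ℝ) < #U := by
      rcases hUn.eq_or_lt with h0 | h0
      · rw [← h0] at hm'; norm_num at hm'
      · exact h0
    nlinarith
  have hη2 : η ^ 2 ≤ η / 4 := by nlinarith
  have hWη : 3 / 2 ≤ #W * η := by nlinarith
  refine ⟨W, hWU, ?_, hbig, fun x hx => ?_⟩
  · rw [← Finset.card_pos]
    by_contra! h0
    have : (#W : ℝ) = 0 := by exact_mod_cast Nat.le_zero.1 h0
    rw [this] at hWη
    norm_num at hWη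
  · have h3 := hmax (W.erase x) (by
      rw [Finset.mem_powerset]
      exact (Finset.erase_subset _ _).trans hWU)
    have h4 := h.colourVol_erase hx
    have h5 : (#(W.erase x) : ℝ) = #W - 1 := by
      rw [Finset.card_erase_of_mem hx, Nat.cast_sub (Finset.card_pos.2 ⟨x, hx⟩)]
      simp
    simp only [h5] at h3
    nlinarith

theorem missing_matchings (h : RainbowFree C) {f : Fin 5 → V} {m : Fin 5 → Fin 5 → Fin 4}
    (hm : ∀ i j, i ≠ j → C (f i) (f j) = {m i j}ᶜ) (a b c d : Fin 5) (hab : a ≠ b) (hac : a ≠ c)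
    (had : a ≠ d) (hbc : b ≠ c) (hbd : b ≠ d) (hcd : c ≠ d) :
    m a b ≠ m c d ∧ (m a c = m a b ∧ m b d = m c d ∨ m a c = m c d ∧ m b d = m a b) ∧
      (m a d = m a b ∧ m b c = m c d ∨ m a d = m c d ∧ m b c = m a b) := by
  apply missing_colours
  intro i j k hi hj hk
  by_contra! hc
  refine h.free (f a) (f b) (f c) (f d) i ?_ j ?_ k ?_ hc.1 hc.2.1 hc.2.2
  · simpa [hm _ _ hab, hm _ _ hcd] using hi
  · simpa [hm _ _ hac, hm _ _ hbd] using hj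
  · simpa [hm _ _ had, hm _ _ hbc] using hk

/-- Each pair misses one colour. Within four points opposite pairs miss different colours, and
always the same two; comparing the five four-point sets, these two are the same throughout. The
missing colours would then properly 2-colour the Petersen graph of disjoint pairs, which contains
5-cycles. -/
theorem not_forall_card_eq_three (h : RainbowFree C) (f : Fin 5 → V)
    (hf : ∀ i j, i ≠ j → #(C (f i) (f j)) = 3) : False := by
  have key : ∀ X : Finset (Fin 4), #X = 3 → ∃ m, X = {m}ᶜ := by decide
  have : ∀ i j, ∃ m, i ≠ j → C (f i) (f j) = {m}ᶜ := fun i j => by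
    by_cases hij : i = j
    · exact ⟨0, fun h => (h hij).elim⟩
    · obtain ⟨m, hm⟩ := key _ (hf i j hij)
      exact ⟨m, fun _ => hm⟩
  choose m hm using this
  have hs : ∀ i j, i ≠ j → m i j = m j i := fun i j hij => by
    have h1 := hm i j hij
    rw [h.symm, hm j i hij.symm] at h1
    simpa using h1.symm
  have q := h.missing_matchings hm
  have q1 := q 0 1 2 3 (by decide) (by decide) (by decide) (by decide) (by decide) (by decide)
  have q2 := q 0 1 2 4 (by decide) (by decide) (by decide) (by decide) (by decide) (by decide)
  have q3 := q 0 1 3 4 (by decide) (by decide) (by decide) (by decide) (by decide) (by decide)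
  have q4 := q 0 2 3 4 (by decide) (by decide) (by decide) (by decide) (by decide) (by decide)
  have q5 := q 1 2 3 4 (by decide) (by decide) (by decide) (by decide) (by decide) (by decide)
  clear q hs hm
  grind

theorem exists_full_pair (h : RainbowFree C) {W : Finset V} (hW : W.Nonempty) {γ : ℝ}
    (hγ : γ < 1 / 7) (hd : ∀ x ∈ W, (3 - γ) * #W ≤ colourDeg C W x) :
    ∃ x ∈ W, ∃ y ∈ W, #(C x y) = 4 := by
  classical
  by_contra! hfull
  have h3 : ∀ x ∈ W, ∀ y ∈ W, #(C x y) ≤ 3 := fun x hx y hy => by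
    have h2 := hfull x hx y hy
    have h3 := card_colours_le (C x y)
    omega
  have hpos : (0 : ℝ) < #W := by exact_mod_cast hW.card_pos
  have h1 : colourVol C W ≤ 2 * (#W : ℝ) ^ 2 + pairCount W (fun x y => #(C x y) = 3) := by
    rw [← pairCount_true, pairCount_eq_sum, pairCount_eq_sum]
    simp only [colourVol, colourDeg, Finset.mul_sum, ← Finset.sum_add_distrib]
    refine Finset.sum_le_sum fun x hx => Finset.sum_le_sum fun y hy => ?_
    have h4 := h3 x hx y hy
    rw [if_pos trivial]
    split_ifs with h5
    · rw [h5]; norm_num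
    · have : #(C x y) ≤ 2 := by omega
      have : (#(C x y) : ℝ) ≤ 2 := by exact_mod_cast this
      linarith
  have h2 : (3 - γ) * (#W : ℝ) ^ 2 ≤ colourVol C W := by
    calc (3 - γ) * (#W : ℝ) ^ 2 = ∑ _x ∈ W, (3 - γ) * #W := by simp; ring
      _ ≤ _ := Finset.sum_le_sum hd
  -- Pairs with exactly three colours have density at least `1 - γ > 3/4`, which forces a `K₅`.
  obtain ⟨f, -, hclique⟩ := exists_clique_of_pairCount (U := W) (G := fun x y => #(C x y) = 3)
    (fun x y hxy => by rwa [h.symm]) (fun x => by simp [h.irrefl]) (r := 4) (by norm_num)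
    (by push_cast; nlinarith)
  exact h.not_forall_card_eq_three f hclique

/-- If `xy` is full and `t` has three colours to both `x` and `y`, then `t` has at most two colours
to every vertex having six colours to `x` and `y`. -/
theorem card_le_two_of_three_three (h : RainbowFree C) {x y z t : V} (hxy : #(C x y) = 4)
    (hxt : #(C x t) = 3) (hyt : #(C y t) = 3) (hz : #(C x z) + #(C y z) = 6) :
    #(C t z) ≤ 2 := by
  have h1 := h.card_matchings x y t z
  simp only [inter_card_of_full hxy] at h1
  have h2 := card_add_card_le_inter (C x t) (C y z)
  have h3 := card_add_card_le_inter (C x z) (C y t)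
  have h4 := card_colours_le (C x z)
  have h5 := card_colours_le (C y z)
  omega

theorem disjoint_of_full (h : RainbowFree C) {a b c d : V} (hac : #(C a c) = 4)
    (hbd : #(C b d) = 4) (had : #(C a d) = 4) (hbc : #(C b c) = 4) :
    Disjoint (C a b) (C c d) := by
  have h1 := h.card_matchings a b c d
  simp only [inter_card_of_full hac, inter_card_of_full had, hbd, hbc] at h1
  rw [Finset.disjoint_iff_inter_eq_empty, ← Finset.card_eq_zero]
  omega

theorem eq_compl_of_disjoint_of_card {P Q : Finset (Fin 4)} (hd : Disjoint P Q) (hP : #P = 2)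
    (hQ : #Q = 2) : Q = Pᶜ := by
  refine Finset.eq_of_subset_of_card_le ?_ ?_
  · rwa [Finset.subset_compl_iff_disjoint_left]
  · rw [Finset.card_compl, hP, hQ]; simp

theorem colourDeg_le_of_bounds {W A B : Finset V} [DecidableEq V] (hA : A ⊆ W) (hB : B ⊆ W)
    (hAB : Disjoint A B) {x : V} (hxA : ∀ y ∈ A, #(C x y) ≤ 2) :
    colourDeg C W x + #{y ∈ B | #(C x y) ≠ 4} ≤ 4 * #W - 2 * #A := by
  have h1 : colourDeg C W x + #{y ∈ B | #(C x y) ≠ 4} + 2 * #A =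
      ∑ y ∈ W, ((#(C x y) : ℝ) + (if y ∈ B ∧ #(C x y) ≠ 4 then 1 else 0)
        + (if y ∈ A then 2 else 0)) := by
    rw [Finset.sum_add_distrib, Finset.sum_add_distrib, colourDeg]
    congr 1
    · congr 1
      rw [Finset.sum_boole]
      congr 2
      ext y
      simp only [mem_filter]
      exact ⟨fun hh => ⟨hB hh.1, hh⟩, fun hh => hh.2⟩
    · rw [Finset.sum_ite_mem, Finset.inter_eq_right.2 hA]
      simp [mul_comm]
  have h2 : colourDeg C W x + #{y ∈ B | #(C x y) ≠ 4} + 2 * #A ≤ 4 * #W := by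
    rw [h1]
    calc _ ≤ ∑ _y ∈ W, (4 : ℝ) := Finset.sum_le_sum fun y hy => by
          have h4 := card_colours_le (C x y)
          by_cases hyA : y ∈ A
          · have hyB : y ∉ B := Finset.disjoint_left.1 hAB hyA
            have : (#(C x y) : ℝ) ≤ 2 := by exact_mod_cast hxA y hyA
            simp only [hyA, hyB, false_and, if_true, if_false]
            linarith
          · by_cases hyB : y ∈ B ∧ #(C x y) ≠ 4
            · have : #(C x y) ≤ 3 := by have := hyB.2; omega
              have : (#(C x y) : ℝ) ≤ 3 := by exact_mod_cast this
              rw [if_pos hyB, if_neg hyA]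
              linarith
            · have : (#(C x y) : ℝ) ≤ 4 := by exact_mod_cast h4
              rw [if_neg hyB, if_neg hyA]
              linarith
      _ = 4 * #W := by simp [mul_comm]
  linarith

/-- A rainbow-free colouring of large minimum degree is close to the extremal one. -/
theorem exists_parts_of_minDegree (h : RainbowFree C) {W : Finset V} (hW : W.Nonempty) {γ : ℝ}
    (hγ0 : 0 ≤ γ) (hγ : γ < 1 / 100) (hd : ∀ x ∈ W, (3 - γ) * #W ≤ colourDeg C W x) :
    ∃ A B : Finset V, A ⊆ W ∧ B ⊆ W ∧ Disjoint A B ∧ (1 / 2 - 9 * γ) * #W ≤ #A ∧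
      (1 / 2 - 9 * γ) * #W ≤ #B ∧ ∃ P : Finset (Fin 4),
        (∀ x ∈ A, ∀ y ∈ A, C x y ⊆ P) ∧ ∀ x ∈ B, ∀ y ∈ B, C x y ⊆ Pᶜ := by
  classical
  have hγ7 : γ < 1 / 7 := by linarith
  have hpos : (0 : ℝ) < #W := by exact_mod_cast hW.card_pos
  obtain ⟨x, hx, y, hy, hxy⟩ := h.exists_full_pair hW hγ7 hd
  have hsix : ∀ z ∈ W, #(C x z) + #(C y z) ≤ 6 := fun z hz => h.add_le_six hW hγ7 hd hx hy hz hxy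
  -- `Z` collects the vertices falling short of the bound 6 for the full pair `xy`; the others have
  -- patterns (2,4), (3,3) or (4,2). Pattern (3,3) would force degree about `2 * #W`, so `A` and `B`
  -- exhaust the rest.
  set Z : Finset V := {z ∈ W | #(C x z) + #(C y z) ≠ 6} with hZ
  set A : Finset V := {z ∈ W | #(C x z) = 2 ∧ #(C y z) = 4} with hA
  set B : Finset V := {z ∈ W | #(C x z) = 4 ∧ #(C y z) = 2} with hB
  have hAW : A ⊆ W := Finset.filter_subset _ _
  have hBW : B ⊆ W := Finset.filter_subset _ _
  have hZcard : (#Z : ℝ) ≤ 2 * γ * #W := by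
    have h1 : colourDeg C W x + colourDeg C W y + #Z ≤ 6 * #W := by
      rw [hZ, Finset.card_filter]
      push_cast
      simp only [colourDeg, ← Finset.sum_add_distrib]
      calc _ ≤ ∑ _z ∈ W, (6 : ℝ) := Finset.sum_le_sum fun z hz => by
            have h1 := hsix z hz
            split_ifs with h2
            · exact_mod_cast (show #(C x z) + #(C y z) + 1 ≤ 6 by omega)
            · exact_mod_cast (show #(C x z) + #(C y z) + 0 ≤ 6 by omega)
        _ = 6 * #W := by simp [mul_comm]
    linarith [hd x hx, hd y hy]
  have hno33 : ∀ t ∈ W, ¬ (#(C x t) = 3 ∧ #(C y t) = 3) := by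
    rintro t ht ⟨hxt, hyt⟩
    have h1 : colourDeg C W t ≤ 2 * #W + 2 * #Z := by
      rw [hZ, Finset.card_filter]
      push_cast
      rw [Finset.mul_sum, colourDeg]
      calc _ ≤ ∑ z ∈ W, (2 + 2 * (if #(C x z) + #(C y z) ≠ 6 then (1 : ℝ) else 0)) :=
            Finset.sum_le_sum fun z hz => by
              split_ifs with h2
              · have : (#(C t z) : ℝ) ≤ 4 := by exact_mod_cast card_colours_le (C t z)
                linarith
              · have : (#(C t z) : ℝ) ≤ 2 := by
                  exact_mod_cast h.card_le_two_of_three_three hxy hxt hyt (not_not.1 h2)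
                linarith
        _ = _ := by rw [Finset.sum_add_distrib]; simp [mul_comm]
    have h2 := hd t ht
    nlinarith
  have hAB : Disjoint A B := by
    rw [Finset.disjoint_left]
    intro z hzA hzB
    simp only [hA, hB, mem_filter] at hzA hzB
    omega
  have hcov : W ⊆ A ∪ B ∪ Z := by
    intro z hz
    simp only [hA, hB, hZ, mem_union, mem_filter, hz, true_and]
    by_contra hc
    have h1 := hsix z hz
    have h2 := hno33 z hz
    have h3 := h.no_heavy_triangle hW hγ7 hd (x := z) (y := y) (z := x) hz hy hx
    have h4 := h.no_heavy_triangle hW hγ7 hd (x := z) (y := x) (z := y) hz hx hy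
    have h5 := card_colours_le (C x z)
    have h6 := card_colours_le (C y z)
    omega
  have hcard : (#W : ℝ) ≤ #A + #B + #Z := by
    have h1 := Finset.card_le_card hcov
    have h2 := Finset.card_union_le (A ∪ B) Z
    have h3 := Finset.card_union_le A B
    exact_mod_cast (show #W ≤ #A + #B + #Z by omega)
  have hcard' : (#A : ℝ) + #B ≤ #W := by
    rw [← Nat.cast_add, ← Finset.card_union_of_disjoint hAB]
    exact_mod_cast Finset.card_le_card (Finset.union_subset hAW hBW)
  have hinA : ∀ z ∈ A, ∀ t ∈ A, #(C z t) ≤ 2 := fun z hz t ht => by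
    simp only [hA, mem_filter] at hz ht
    exact h.no_heavy_triangle hW hγ7 hd hz.1 ht.1 hy (by rw [h.symm]; exact hz.2.2)
      (by rw [h.symm]; exact ht.2.2)
  have hinB : ∀ z ∈ B, ∀ t ∈ B, #(C z t) ≤ 2 := fun z hz t ht => by
    simp only [hB, mem_filter] at hz ht
    exact h.no_heavy_triangle hW hγ7 hd hz.1 ht.1 hx (by rw [h.symm]; exact hz.2.1)
      (by rw [h.symm]; exact ht.2.1)
  have hdA : ∀ z ∈ A, (#{u ∈ B | #(C z u) ≠ 4} : ℝ) ≤ (1 + γ) * #W - 2 * #A := fun z hz => by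
    have h1 := colourDeg_le_of_bounds hAW hBW hAB (hinA z hz)
    linarith [hd z (hAW hz)]
  have hdB : ∀ u ∈ B, (#{z ∈ A | #(C u z) ≠ 4} : ℝ) ≤ (1 + γ) * #W - 2 * #B := fun u hu => by
    have h1 := colourDeg_le_of_bounds hBW hAW hAB.symm (hinB u hu)
    linarith [hd u (hBW hu)]
  -- The deficiency bounds `hdA` and `hdB` count a set, so their right-hand sides are nonnegative.
  -- This caps both parts near half of `W`, and covering then bounds both from below.
  have hcontra : ∀ S : Finset V, (∀ z ∈ S, 0 ≤ (1 + γ) * (#W : ℝ) - 2 * #S) →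
      (#S : ℝ) ≤ (1 + γ) / 2 * #W := fun S hS => by
    rcases S.eq_empty_or_nonempty with rfl | ⟨z, hz⟩
    · simp; positivity
    · linarith [hS z hz]
  have hA1 := hcontra A fun z hz => (Nat.cast_nonneg _).trans (hdA z hz)
  have hB1 := hcontra B fun u hu => (Nat.cast_nonneg _).trans (hdB u hu)
  have hB0 : B.Nonempty := by
    rw [← Finset.card_pos]
    have : (0 : ℝ) < #B := by nlinarith
    exact_mod_cast this
  obtain ⟨u, hu⟩ := hB0
  have hfullu : (#A : ℝ) - 6 * γ * #W ≤ #{z ∈ A | #(C u z) = 4} := by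
    have h1 := Finset.card_filter_add_card_filter_not (s := A) (fun z => #(C u z) = 4)
    have h2 : (#{z ∈ A | #(C u z) = 4} : ℝ) + #{z ∈ A | #(C u z) ≠ 4} = #A := by exact_mod_cast h1
    linarith [hdB u hu]
  have hne : (0 : ℝ) < #{z ∈ A | #(C u z) = 4} := by nlinarith
  obtain ⟨z, hz⟩ := Finset.card_pos.1 (Nat.cast_pos.1 hne)
  obtain ⟨hzA, hzu⟩ := Finset.mem_filter.1 hz
  have hfullz : (#B : ℝ) - 6 * γ * #W ≤ #{v ∈ B | #(C z v) = 4} := by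
    have h1 := Finset.card_filter_add_card_filter_not (s := B) (fun v => #(C z v) = 4)
    have h2 : (#{v ∈ B | #(C z v) = 4} : ℝ) + #{v ∈ B | #(C z v) ≠ 4} = #B := by exact_mod_cast h1
    linarith [hdA z hzA]
  have hzA' := hzA
  have hu' := hu
  simp only [hA, mem_filter] at hzA'
  simp only [hB, mem_filter] at hu'
  -- The pairs `xy`, `yz`, `zu`, `ux` form a full 4-cycle, so its diagonals carry complementary
  -- colour pairs. Pairs inside the final parts are compared with these diagonals through further
  -- full 4-cycles.
  have hP : C y u = (C x z)ᶜ := by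
    refine eq_compl_of_disjoint_of_card ?_ hzA'.2.1 hu'.2.2
    exact h.disjoint_of_full hxy (by rwa [h.symm]) hu'.2.1 (by rw [h.symm]; exact hzA'.2.2)
  refine ⟨{z ∈ A | #(C u z) = 4}, {v ∈ B | #(C z v) = 4}, (Finset.filter_subset _ _).trans hAW,
    (Finset.filter_subset _ _).trans hBW,
    hAB.mono (Finset.filter_subset _ _) (Finset.filter_subset _ _), by nlinarith, by nlinarith,
    C x z, fun p hp q hq => ?_, fun p hp q hq => ?_⟩
  · simp only [hA, mem_filter] at hp hq
    rw [← compl_compl (C x z), ← hP, Finset.subset_compl_iff_disjoint_left]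
    refine (h.disjoint_of_full ?_ ?_ ?_ ?_).symm
    · rw [h.symm]; exact hp.1.2.2
    · rw [h.symm]; exact hq.2
    · rw [h.symm]; exact hp.2
    · rw [h.symm]; exact hq.1.2.2
  · simp only [hB, mem_filter] at hp hq
    rw [Finset.subset_compl_iff_disjoint_left]
    exact h.disjoint_of_full hp.1.2.1 hq.2 hq.1.2.1 hp.2

end RainbowFree

end Rainbow

/-! ### Hyperedges, links and tetrahedra -/

namespace UniformHypergraph

variable {V : Type*} [DecidableEq V]

/-- The vertices `x`, `y`, `z` form a hyperedge. -/
def Triple (H : UniformHypergraph 3 V) (x y z : V) : Prop := ({x, y, z} : Finset V) ∈ H.edges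

instance (H : UniformHypergraph 3 V) (x y z : V) : Decidable (H.Triple x y z) :=
  inferInstanceAs (Decidable (_ ∈ H.edges))

variable {H : UniformHypergraph 3 V} {x y z : V}

theorem Triple.swap (h : H.Triple x y z) : H.Triple y x z := by
  rw [Triple, Finset.insert_comm]; exact h

theorem Triple.swap' (h : H.Triple x y z) : H.Triple x z y := by
  rw [Triple, Finset.pair_comm]; exact h

theorem triple_swap : H.Triple x y z ↔ H.Triple y x z := ⟨Triple.swap, Triple.swap⟩

theorem triple_swap' : H.Triple x y z ↔ H.Triple x z y := ⟨Triple.swap', Triple.swap'⟩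

theorem Triple.rotate (h : H.Triple x y z) : H.Triple y z x := h.swap.swap'

theorem Triple.ne (h : H.Triple x y z) : x ≠ y := by
  rintro rfl
  have h1 := H.uniform _ h
  rw [Finset.insert_eq_of_mem (by simp)] at h1
  have := Finset.card_le_two (a := x) (b := z)
  omega

theorem Triple.ne' (h : H.Triple x y z) : y ≠ z := h.rotate.ne

theorem Triple.ne'' (h : H.Triple x y z) : x ≠ z := h.swap'.ne

/-- `xyz` serves as one Fano line; the three perfect matchings of `a, b, c, d` supply the other six.
Distinctness of the seven points follows from the triples themselves. -/
theorem Free.no_fano_triples (hH : H.Free fano) {x y z a b c d : V} (h1 : H.Triple x y z)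
    (h2 : H.Triple x a b) (h3 : H.Triple x c d) (h4 : H.Triple y a c) (h5 : H.Triple y b d)
    (h6 : H.Triple z a d) (h7 : H.Triple z b c) : False := by
  apply hH
  -- the lines of `fano` are `013, 124, 235, 346, 450, 561, 602`
  let f : Fin 7 → V := ![x, y, a, z, c, d, b]
  have hf : Function.Injective f := by
    have := h1.ne; have := h1.ne'; have := h1.ne''
    have := h2.ne; have := h2.ne'; have := h2.ne''
    have := h3.ne; have := h3.ne'; have := h3.ne''
    have := h4.ne; have := h4.ne'; have := h4.ne''
    have := h5.ne; have := h5.ne'; have := h5.ne''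
    have := h6.ne; have := h6.ne'; have := h6.ne''
    have := h7.ne; have := h7.ne'; have := h7.ne''
    intro i j hij
    fin_cases i <;> fin_cases j <;> first | rfl | (exfalso; simp [f] at hij; simp_all)
  refine ⟨⟨f, hf⟩, fun e he => ?_⟩
  simp only [fano, Finset.mem_insert, Finset.mem_singleton] at he
  rcases he with rfl | rfl | rfl | rfl | rfl | rfl | rfl <;>
    simp only [Finset.map_insert, Finset.map_singleton, Function.Embedding.coeFn_mk, f]
  · exact h1
  · exact h4
  · exact h6.swap
  · exact h7.swap'
  · exact h3.rotate
  · exact h5.rotate.swap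
  · exact h2.rotate.rotate

/-- The number of ordered pairs of elements of `U` forming a hyperedge with `x`. -/
noncomputable def linkDeg (H : UniformHypergraph 3 V) (U : Finset V) (x : V) : ℝ :=
  pairCount U (H.Triple x)

/-- The number of ordered triples of elements of `U` forming a hyperedge. -/
noncomputable def vol (H : UniformHypergraph 3 V) (U : Finset V) : ℝ := ∑ x ∈ U, H.linkDeg U x

theorem linkDeg_eq_sum (H : UniformHypergraph 3 V) (U : Finset V) (x : V) :
    H.linkDeg U x = ∑ y ∈ U, ∑ z ∈ U, if H.Triple x y z then (1 : ℝ) else 0 := by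
  rw [linkDeg, pairCount_eq_sum]
  congr!

theorem vol_erase (H : UniformHypergraph 3 V) {U : Finset V} {x : V} (hx : x ∈ U) :
    H.vol U = H.vol (U.erase x) + 3 * H.linkDeg U x := by
  set f : V → V → V → ℝ := fun x y z => if H.Triple x y z then (1 : ℝ) else 0 with hf
  have hs : ∀ a b c, f a b c = f b a c := fun a b c => by simp only [hf, triple_swap]
  have hs' : ∀ a b c, f a b c = f a c b := fun a b c => by simp only [hf, triple_swap']
  have h0 : ∀ a b, f a a b = 0 := fun a b => if_neg fun h => h.ne rfl
  have h0' : ∀ a b, f a b a = 0 := fun a b => by rw [hs', h0]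
  have h0'' : ∀ a b, f b a a = 0 := fun a b => by rw [hs, h0']
  have hd : ∀ W y, H.linkDeg W y = ∑ a ∈ W, ∑ b ∈ W, f y a b := H.linkDeg_eq_sum
  have hcodeg : ∀ W y, ∑ a ∈ insert x W, f x y a = ∑ a ∈ W, f x y a := fun W y => by
    by_cases hxW : x ∈ W
    · rw [Finset.insert_eq_of_mem hxW]
    · rw [Finset.sum_insert hxW, h0', zero_add]
  set W := U.erase x with hW
  have hU : U = insert x W := (Finset.insert_erase hx).symm
  have hxW : x ∉ W := Finset.notMem_erase x U
  have h1 : H.linkDeg U x = ∑ a ∈ W, ∑ b ∈ W, f x a b := by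
    rw [hd, hU, Finset.sum_insert hxW]
    simp only [hcodeg, h0, Finset.sum_const_zero, zero_add]
  have h2 : ∀ y, H.linkDeg U y = H.linkDeg W y + 2 * ∑ b ∈ W, f x y b := fun y => by
    rw [hd, hd, hU, Finset.sum_insert hxW, Finset.sum_insert hxW]
    simp only [Finset.sum_insert hxW, Finset.sum_add_distrib, h0'', hs y x]
    have : ∑ a ∈ W, f y a x = ∑ b ∈ W, f x y b :=
      Finset.sum_congr rfl fun a _ => by rw [hs', hs]
    rw [this]
    ring
  rw [vol, hU, Finset.sum_insert hxW, ← hU, Finset.sum_congr rfl fun y _ => h2 y,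
    Finset.sum_add_distrib, ← Finset.mul_sum, ← h1, vol]
  ring

/-- The four vertices `s 0, …, s 3` span a complete `3`-uniform hypergraph. -/
def IsTetrahedron (H : UniformHypergraph 3 V) (s : Fin 4 → V) : Prop :=
  ∀ i j k, i ≠ j → i ≠ k → j ≠ k → H.Triple (s i) (s j) (s k)

theorem isTetrahedron_of_triples {H : UniformHypergraph 3 V} {a b c d : V} (h1 : H.Triple a b c)
    (h2 : H.Triple a b d) (h3 : H.Triple a c d) (h4 : H.Triple b c d) :
    H.IsTetrahedron ![a, b, c, d] := by
  intro i j k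
  fin_cases i <;> fin_cases j <;> fin_cases k <;> intro hij hik hjk <;>
    first
    | exact absurd rfl hij
    | exact absurd rfl hik
    | exact absurd rfl hjk
    | exact h1
    | exact h2
    | exact h3
    | exact h4
    | exact h1.swap
    | exact h2.swap
    | exact h3.swap
    | exact h4.swap
    | exact h1.swap'
    | exact h2.swap'
    | exact h3.swap'
    | exact h4.swap'
    | exact h1.rotate
    | exact h2.rotate
    | exact h3.rotate
    | exact h4.rotate
    | exact h1.rotate.rotate
    | exact h2.rotate.rotate
    | exact h3.rotate.rotate
    | exact h4.rotate.rotate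
    | exact h1.rotate.swap
    | exact h2.rotate.swap
    | exact h3.rotate.swap
    | exact h4.rotate.swap

/-- Density more than `2 / 3` forces a tetrahedron. -/
theorem exists_isTetrahedron (H : UniformHypergraph 3 V) {U : Finset V}
    (h : 2 / 3 * (#U : ℝ) ^ 3 < H.vol U) :
    ∃ s : Fin 4 → V, (∀ i, s i ∈ U) ∧ H.IsTetrahedron s := by
  by_contra! hno
  set f : V → V → V → ℝ := fun x y z => if H.Triple x y z then (1 : ℝ) else 0 with hf
  have hs : ∀ a b c, f a b c = f b a c := fun a b c => by simp only [hf, triple_swap]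
  have hs' : ∀ a b c, f a b c = f a c b := fun a b c => by simp only [hf, triple_swap']
  have hv : H.vol U = ∑ x ∈ U, ∑ y ∈ U, ∑ z ∈ U, f x y z :=
    Finset.sum_congr rfl fun x _ => H.linkDeg_eq_sum U x
  set g : V → V → ℝ := fun x y => ∑ z ∈ U, f x y z with hg
  -- No `t` can complete a hyperedge to a tetrahedron, so each `t` is counted in at most two of the
  -- three codegrees. Summing over hyperedges bounds the sum of squared codegrees, and
  -- Cauchy–Schwarz finishes.
  have hpt : ∀ x ∈ U, ∀ y ∈ U, ∀ z ∈ U,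
      f x y z * (g x y + g x z + g y z) ≤ f x y z * (2 * #U) := by
    intro x hx y hy z hz
    by_cases hT : H.Triple x y z
    · refine mul_le_mul_of_nonneg_left ?_ (by simp only [hf]; positivity)
      simp only [hg, ← Finset.sum_add_distrib]
      calc _ ≤ ∑ _t ∈ U, (2 : ℝ) := Finset.sum_le_sum fun t ht => by
            simp only [hf]
            by_cases h1 : H.Triple x y t
            · by_cases h2 : H.Triple x z t
              · by_cases h3 : H.Triple y z t
                · refine absurd (isTetrahedron_of_triples hT h1 h2 h3) (hno _ fun i => ?_)
                  fin_cases i <;> simpa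
                · norm_num [h1, h2, h3]
              · by_cases h3 : H.Triple y z t <;> norm_num [h1, h2, h3]
            · by_cases h2 : H.Triple x z t <;> by_cases h3 : H.Triple y z t <;>
                norm_num [h1, h2, h3]
        _ = 2 * #U := by simp [mul_comm]
    · simp [hf, hT]
  have hsum : ∑ x ∈ U, ∑ y ∈ U, ∑ z ∈ U, f x y z * (g x y + g x z + g y z) ≤
      2 * #U * H.vol U := by
    calc _ ≤ ∑ x ∈ U, ∑ y ∈ U, ∑ z ∈ U, f x y z * (2 * #U) :=
          Finset.sum_le_sum fun x hx => Finset.sum_le_sum fun y hy =>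
            Finset.sum_le_sum fun z hz => hpt x hx y hy z hz
      _ = _ := by
          simp only [← Finset.sum_mul]
          rw [hv, mul_comm]
  have e1 : ∑ x ∈ U, ∑ y ∈ U, ∑ z ∈ U, f x y z * g x y = ∑ x ∈ U, ∑ y ∈ U, g x y ^ 2 := by
    refine Finset.sum_congr rfl fun x _ => Finset.sum_congr rfl fun y _ => ?_
    rw [← Finset.sum_mul, sq]
  have e2 : ∑ x ∈ U, ∑ y ∈ U, ∑ z ∈ U, f x y z * g x z = ∑ x ∈ U, ∑ y ∈ U, g x y ^ 2 := by
    rw [← e1]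
    refine Finset.sum_congr rfl fun x _ => ?_
    rw [Finset.sum_comm]
    exact Finset.sum_congr rfl fun y _ => Finset.sum_congr rfl fun z _ => by rw [hs']
  have e3 : ∑ x ∈ U, ∑ y ∈ U, ∑ z ∈ U, f x y z * g y z = ∑ x ∈ U, ∑ y ∈ U, g x y ^ 2 := by
    rw [← e2, Finset.sum_comm]
    exact Finset.sum_congr rfl fun y _ => Finset.sum_congr rfl fun x _ =>
      Finset.sum_congr rfl fun z _ => by rw [hs]
  have hcs : H.vol U ^ 2 ≤ (#U : ℝ) ^ 2 * ∑ x ∈ U, ∑ y ∈ U, g x y ^ 2 := by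
    have h1 := sq_sum_le_card_mul_sum_sq (s := U ×ˢ U) (f := fun p => g p.1 p.2)
    rw [Finset.sum_product, Finset.sum_product, Finset.card_product] at h1
    rw [hv]
    push_cast at h1
    calc _ ≤ _ := h1
      _ = _ := by ring
  simp only [mul_add, Finset.sum_add_distrib, e1, e2, e3] at hsum
  have hpos : 0 < H.vol U := lt_of_le_of_lt (by positivity) h
  have h3 : 3 * H.vol U ^ 2 ≤ 2 * (#U : ℝ) ^ 3 * H.vol U := by
    nlinarith [sq_nonneg (#U : ℝ)]
  nlinarith

/-- The colours of a pair with respect to `s`: the indices `i` whose link contains the pair. -/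
def linkColours (H : UniformHypergraph 3 V) (s : Fin 4 → V) (x y : V) : Finset (Fin 4) :=
  {i | H.Triple (s i) x y}

theorem mem_linkColours {H : UniformHypergraph 3 V} {s : Fin 4 → V} {x y : V} {i : Fin 4} :
    i ∈ H.linkColours s x y ↔ H.Triple (s i) x y := by simp [linkColours]

theorem Free.rainbowFree {H : UniformHypergraph 3 V} (hH : H.Free fano) {s : Fin 4 → V}
    (hs : H.IsTetrahedron s) : RainbowFree (H.linkColours s) where
  symm x y := by
    ext i
    rw [mem_linkColours, mem_linkColours, triple_swap']
  irrefl x := by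
    ext i
    simp only [mem_linkColours, notMem_empty, iff_false]
    exact fun h => h.ne' rfl
  free a b c d i hi j hj k hk hij hik hjk := by
    simp only [mem_inter, mem_linkColours] at hi hj hk
    exact hH.no_fano_triples (hs i j k hij hik hjk) hi.1 hi.2 hj.1 hj.2 hk.1 hk.2

theorem colourVol_linkColours (H : UniformHypergraph 3 V) (s : Fin 4 → V) (U : Finset V) :
    RainbowFree.colourVol (H.linkColours s) U = ∑ i, H.linkDeg U (s i) := by
  simp only [linkDeg_eq_sum]
  rw [Finset.sum_comm, RainbowFree.colourVol]
  refine Finset.sum_congr rfl fun x _ => ?_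
  rw [Finset.sum_comm, RainbowFree.colourDeg]
  refine Finset.sum_congr rfl fun y _ => ?_
  rw [linkColours, Finset.card_filter]
  push_cast
  rfl

/-- An asymptotically sharp bound for Fano-free hypergraphs. -/
theorem Free.vol_le {H : UniformHypergraph 3 V} (hH : H.Free fano) (U : Finset V) :
    H.vol U ≤ 3 / 4 * (#U : ℝ) ^ 3 + 9 / 2 * (#U : ℝ) ^ 2 := by
  induction hn : #U generalizing U with
  | zero =>
    rw [Finset.card_eq_zero] at hn
    simp [hn, vol]
  | succ n ih =>
    -- Otherwise the density exceeds `2/3`, there is a tetrahedron, and its four links together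
    -- violate `RainbowFree.colourVol_le`.
    have hx : ∃ x ∈ U, H.linkDeg U x ≤ 3 / 4 * (#U : ℝ) ^ 2 + 3 / 4 * #U := by
      by_contra! hd
      have hpos : (0 : ℝ) < #U := by rw [hn]; positivity
      have h1 : 3 / 4 * (#U : ℝ) ^ 3 ≤ H.vol U := by
        calc _ = ∑ _x ∈ U, 3 / 4 * (#U : ℝ) ^ 2 := by simp; ring
          _ ≤ _ := Finset.sum_le_sum fun x hx => by
            have := hd x hx
            linarith
      obtain ⟨s, hsU, hs⟩ := H.exists_isTetrahedron (U := U) (by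
        have : (0 : ℝ) < (#U : ℝ) ^ 3 := by positivity
        linarith)
      have h2 := (hH.rainbowFree hs).colourVol_le U
      rw [colourVol_linkColours, Fin.sum_univ_four] at h2
      linarith [hd _ (hsU 0), hd _ (hsU 1), hd _ (hsU 2), hd _ (hsU 3)]
    obtain ⟨x, hx, hdx⟩ := hx
    have h1 := ih (U.erase x) (by rw [Finset.card_erase_of_mem hx]; omega)
    rw [H.vol_erase hx]
    rw [hn] at hdx
    push_cast at hdx ⊢
    have : (0 : ℝ) ≤ n := Nat.cast_nonneg n
    nlinarith

/-- The vertex set of a tetrahedron of large degree determines a bipartition for which each of its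
links avoids the pairs inside one part. -/
theorem Free.exists_parts {H : UniformHypergraph 3 V} (hH : H.Free fano) {s : Fin 4 → V}
    (hs : H.IsTetrahedron s) {U : Finset V} {η : ℝ} (hη : 0 < η) (hη1 : η ≤ 1 / 1000)
    (hm : 6 / η ^ 2 ≤ #U) (hd : ∀ i, (3 / 4 - η ^ 2 / 4) * (#U : ℝ) ^ 2 ≤ H.linkDeg U (s i)) :
    ∃ A B : Finset V, A ⊆ U ∧ B ⊆ U ∧ Disjoint A B ∧ (1 / 2 - 20 * η) * #U ≤ #A ∧
      (1 / 2 - 20 * η) * #U ≤ #B ∧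
      ∀ i, (∀ y ∈ B, ∀ z ∈ B, ¬ H.Triple (s i) y z) ∨
        (∀ y ∈ A, ∀ z ∈ A, ¬ H.Triple (s i) y z) := by
  have hR := hH.rainbowFree hs
  obtain ⟨W, hWU, hWne, hWcard, hWd⟩ := hR.exists_large_minDegree U hη (by linarith) hm (by
    rw [colourVol_linkColours, Fin.sum_univ_four]
    linarith [hd 0, hd 1, hd 2, hd 3])
  obtain ⟨A, B, hA, hB, hAB, hAc, hBc, P, hPA, hPB⟩ :=
    hR.exists_parts_of_minDegree hWne (γ := 2 * η) (by linarith) (by linarith) hWd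
  have hU0 : (0 : ℝ) ≤ #U := Nat.cast_nonneg _
  have hcard : (1 / 2 - 20 * η) * #U ≤ (1 / 2 - 9 * (2 * η)) * (#W : ℝ) := by
    have h1 : (1 / 2 - 9 * (2 * η)) * ((1 - 2 * η) * #U) ≤ (1 / 2 - 9 * (2 * η)) * (#W : ℝ) :=
      mul_le_mul_of_nonneg_left hWcard (by linarith)
    have h2 : 0 ≤ η ^ 2 * (#U : ℝ) := by positivity
    have h3 : 0 ≤ η * (#U : ℝ) := by positivity
    nlinarith
  refine ⟨A, B, hA.trans hWU, hB.trans hWU, hAB, hcard.trans hAc, hcard.trans hBc, fun i => ?_⟩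
  by_cases hi : i ∈ P
  · left
    intro y hy z hz hT
    have := hPB y hy z hz (mem_linkColours.2 hT)
    exact (Finset.mem_compl.1 this) hi
  · right
    intro y hy z hz hT
    exact hi (hPA y hy z hz (mem_linkColours.2 hT))

end UniformHypergraph

/-! ### From one tetrahedron to a bipartition of almost all vertices -/

namespace UniformHypergraph

variable {V : Type*} [DecidableEq V] {H : UniformHypergraph 3 V}

theorem not_triple_self (x y : V) : ¬ H.Triple x y y := fun h => h.ne' rfl

/-- A large link without pairs inside a large set `S` contains almost all other pairs. -/
theorem pairCount_missing_le {U S : Finset V} {η : ℝ} (hη : 0 < η) (hη1 : η ≤ 1 / 1000)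
    (hS : S ⊆ U) (hc : (1 / 2 - 20 * η) * #U ≤ #S) {x : V}
    (hd : (3 / 4 - η ^ 2 / 4) * (#U : ℝ) ^ 2 ≤ H.linkDeg U x)
    (hx : ∀ y ∈ S, ∀ z ∈ S, ¬ H.Triple x y z) :
    pairCount U (fun y z => ¬ (y ∈ S ∧ z ∈ S) ∧ ¬ H.Triple x y z) ≤ 21 * η * (#U : ℝ) ^ 2 := by
  have h1 := pairCount_add_le (U := U) (P := fun y z => y ∈ S ∧ z ∈ S)
    (Q := fun y z => ¬ (y ∈ S ∧ z ∈ S) ∧ ¬ H.Triple x y z) (R := fun y z => ¬ H.Triple x y z)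
    (fun y _ z _ h => hx y h.1 z h.2) (fun y _ z _ h => h.2) (fun y _ z _ h h' => h'.1 h)
  have h2 := pairCount_add_le (U := U) (P := H.Triple x)
    (Q := fun y z => ¬ H.Triple x y z) (R := fun _ _ => True)
    (fun y _ z _ h => trivial) (fun y _ z _ h => trivial) (fun y _ z _ h h' => h' h)
  rw [pairCount_mem_mem hS hS] at h1
  rw [pairCount_true] at h2
  change H.linkDeg U x + _ ≤ _ at h2
  have hU : (0 : ℝ) ≤ #U := Nat.cast_nonneg _
  have h3 : ((1 / 2 - 20 * η) * #U) * ((1 / 2 - 20 * η) * #U) ≤ (#S : ℝ) * #S := by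
    have : 0 ≤ (1 / 2 - 20 * η) * (#U : ℝ) := mul_nonneg (by linarith) hU
    gcongr
  have h4 : 0 ≤ (η - η ^ 2 / 4) * (#U : ℝ) ^ 2 := mul_nonneg (by nlinarith) (by positivity)
  have h5 : 0 ≤ η ^ 2 * (#U : ℝ) ^ 2 := by positivity
  nlinarith

/-- Three links with many common pairs inside `S` rule out a hyperedge. -/
theorem Free.not_triple_of_common_link (hH : H.Free fano) {S : Finset V} {x y z : V}
    (h : 2 * (#S : ℝ) ^ 2 <
      3 * pairCount S (fun a b => H.Triple x a b ∧ H.Triple y a b ∧ H.Triple z a b)) :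
    ¬ H.Triple x y z := by
  intro hT
  obtain ⟨f, -, hf⟩ := exists_clique_of_pairCount
    (G := fun a b => H.Triple x a b ∧ H.Triple y a b ∧ H.Triple z a b)
    (fun a b h => ⟨h.1.swap', h.2.1.swap', h.2.2.swap'⟩)
    (fun a h => not_triple_self x a h.1) (r := 3) (by norm_num) (by push_cast; linarith)
  exact hH.no_fano_triples hT (hf 0 1 (by decide)).1 (hf 2 3 (by decide)).1
    (hf 0 2 (by decide)).2.1 (hf 1 3 (by decide)).2.1 (hf 0 3 (by decide)).2.2
    (hf 1 2 (by decide)).2.2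

/-- In a tetrahedron, every link is close to containing the link of a given vertex `p`, or to
containing all pairs inside a large set `B` avoided by the link of `p`. -/
theorem Free.link_dichotomy_of_isTetrahedron (hH : H.Free fano) {U B : Finset V} {η : ℝ}
    (hη : 0 < η) (hη1 : η ≤ 1 / 1000) (hm : 6 / η ^ 2 ≤ #U)
    (hd : ∀ x ∈ U, (3 / 4 - η ^ 2 / 4) * (#U : ℝ) ^ 2 ≤ H.linkDeg U x)
    {s : Fin 4 → V} (hsU : ∀ i, s i ∈ U) (hs : H.IsTetrahedron s)
    (i j : Fin 4) (hj : ∀ y ∈ B, ∀ z ∈ B, ¬ H.Triple (s j) y z) :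
    pairCount U (fun y z => H.Triple (s j) y z ∧ ¬ H.Triple (s i) y z) ≤ 21 * η * (#U : ℝ) ^ 2 ∨
    pairCount U (fun y z => (y ∈ B ∧ z ∈ B) ∧ ¬ H.Triple (s i) y z) ≤ 42 * η * (#U : ℝ) ^ 2 := by
  obtain ⟨A', B', hA, hB, hAB, hAc, hBc, hAB'⟩ := hH.exists_parts hs hη hη1 hm fun i => hd _ (hsU i)
  wlog hjB : ∀ y ∈ B', ∀ z ∈ B', ¬ H.Triple (s j) y z generalizing A' B'
  · exact this B' A' hB hA hAB.symm hBc hAc (fun i => (hAB' i).symm) ((hAB' j).resolve_left hjB)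
  have hmj := pairCount_missing_le hη hη1 hB hBc (hd _ (hsU j)) hjB
  -- If both links avoid `B'`, they nearly coincide outside it. If they avoid opposite parts, they
  -- jointly cover nearly all pairs, and the link of `s j` contributes nothing inside `B`.
  rcases hAB' i with hi | hi
  · left
    refine le_trans (pairCount_mono fun y _ z _ h => ?_)
      (pairCount_missing_le hη hη1 hB hBc (hd _ (hsU i)) hi)
    exact ⟨fun h' => hjB y h'.1 z h'.2 h.1, h.2⟩
  · right
    have hmi := pairCount_missing_le hη hη1 hA hAc (hd _ (hsU i)) hi
    have h1 := pairCount_le_add (U := U)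
      (P := fun y z => (y ∈ B ∧ z ∈ B) ∧ ¬ H.Triple (s i) y z)
      (Q := fun y z => ¬ (y ∈ B' ∧ z ∈ B') ∧ ¬ H.Triple (s j) y z)
      (R := fun y z => ¬ (y ∈ A' ∧ z ∈ A') ∧ ¬ H.Triple (s i) y z)
      (fun y _ z _ h => by
        by_cases hB' : y ∈ B' ∧ z ∈ B'
        · exact Or.inr ⟨fun h' => Finset.disjoint_left.1 hAB h'.1 hB'.1, h.2⟩
        · exact Or.inl ⟨hB', hj y h.1.1 z h.1.2⟩)
    linarith

/-- The dichotomy of `link_dichotomy_of_isTetrahedron` for all vertices `x` which, together with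
`p`, form hyperedges with almost all elements of `A`. -/
theorem Free.link_dichotomy (hH : H.Free fano) {U A B : Finset V} {η : ℝ}
    (hη : 0 < η) (hη1 : η ≤ 1 / 1000) (hm : 6 / η ^ 2 ≤ #U)
    (hd : ∀ x ∈ U, (3 / 4 - η ^ 2 / 4) * (#U : ℝ) ^ 2 ≤ H.linkDeg U x) (hA : A ⊆ U) (hB : B ⊆ U)
    (hAB : Disjoint A B) (hAc : (1 / 2 - 20 * η) * #U ≤ #A) (hBc : (1 / 2 - 20 * η) * #U ≤ #B)
    {p x : V} (hp : p ∈ U) (hx : x ∈ U) (hpB : ∀ y ∈ B, ∀ z ∈ B, ¬ H.Triple p y z)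
    (hpx : (#{y ∈ A | ¬ H.Triple p x y} : ℝ) ≤ #U / 200) :
    pairCount U (fun y z => H.Triple p y z ∧ ¬ H.Triple x y z) ≤ 21 * η * (#U : ℝ) ^ 2 ∨
    pairCount U (fun y z => (y ∈ B ∧ z ∈ B) ∧ ¬ H.Triple x y z) ≤
      (42 * η + 1 / 100) * (#U : ℝ) ^ 2 := by
  have hU : (0 : ℝ) ≤ #U := Nat.cast_nonneg _
  by_cases hK : ∃ y ∈ A, ∃ z ∈ A, H.Triple p x y ∧ H.Triple p x z ∧ H.Triple p y z ∧ H.Triple x y z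
  · obtain ⟨y, hy, z, hz, hxy, hxz, hyz, hT⟩ := hK
    have hs := isTetrahedron_of_triples hT hxy.rotate hxz.rotate hyz.rotate
    have h1 := hH.link_dichotomy_of_isTetrahedron hη hη1 hm hd (s := ![x, y, z, p]) (B := B)
      (fun i => by fin_cases i <;> simp [hx, hp, hA hy, hA hz]) hs 0 3 (by simpa using hpB)
    refine h1.imp (fun h => h) fun h => h.trans ?_
    nlinarith [sq_nonneg (#U : ℝ)]
  -- Now `p` and `x` extend to no tetrahedron using two vertices of `A`. Since nearly all pairs in
  -- `A` lie in the link of `p`, they are missing from that of `x`; its density then leaves almost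
  -- no room for missing pairs inside `B`.
  · push Not at hK
    right
    set N : Finset V := {y ∈ A | ¬ H.Triple p x y} with hN
    have hNU : N ⊆ U := (Finset.filter_subset _ _).trans hA
    have hmp := pairCount_missing_le hη hη1 hB hBc (hd p hp) hpB
    have h1 := pairCount_le_add (U := U)
      (P := fun y z => (y ∈ A ∧ z ∈ A) ∧ H.Triple x y z)
      (Q := fun y z => ¬ (y ∈ B ∧ z ∈ B) ∧ ¬ H.Triple p y z)
      (R := fun y z => (y ∈ N ∧ z ∈ A) ∨ (y ∈ A ∧ z ∈ N))
      (fun y _ z _ h => by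
        by_cases hy : H.Triple p x y
        · by_cases hz : H.Triple p x z
          · exact Or.inl ⟨fun h' => Finset.disjoint_left.1 hAB h.1.1 h'.1,
              fun h' => hK y h.1.1 z h.1.2 hy hz h' h.2⟩
          · exact Or.inr (Or.inr ⟨h.1.1, by simp [hN, h.1.2, hz]⟩)
        · exact Or.inr (Or.inl ⟨by simp [hN, h.1.1, hy], h.1.2⟩))
    have h2 := pairCount_le_add (U := U)
      (P := fun y z => (y ∈ N ∧ z ∈ A) ∨ (y ∈ A ∧ z ∈ N))
      (Q := fun y z => y ∈ N ∧ z ∈ A) (R := fun y z => y ∈ A ∧ z ∈ N) (fun _ _ _ _ h => h)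
    rw [pairCount_mem_mem hNU hA, pairCount_mem_mem hA hNU] at h2
    have h3 := pairCount_le_add (U := U) (P := fun y z => y ∈ A ∧ z ∈ A)
      (Q := fun y z => (y ∈ A ∧ z ∈ A) ∧ H.Triple x y z)
      (R := fun y z => (y ∈ A ∧ z ∈ A) ∧ ¬ H.Triple x y z) (fun y _ z _ h => by tauto)
    rw [pairCount_mem_mem hA hA] at h3
    have h4 := pairCount_add_le (U := U)
      (P := fun y z => (y ∈ A ∧ z ∈ A) ∧ ¬ H.Triple x y z)
      (Q := fun y z => (y ∈ B ∧ z ∈ B) ∧ ¬ H.Triple x y z)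
      (R := fun y z => ¬ H.Triple x y z) (fun y _ z _ h => h.2) (fun y _ z _ h => h.2)
      (fun y _ z _ h h' => Finset.disjoint_left.1 hAB h.1.1 h'.1.1)
    have h5 := pairCount_add_le (U := U) (P := H.Triple x)
      (Q := fun y z => ¬ H.Triple x y z) (R := fun _ _ => True)
      (fun y _ z _ h => trivial) (fun y _ z _ h => trivial) (fun y _ z _ h h' => h' h)
    rw [pairCount_true] at h5
    change H.linkDeg U x + _ ≤ _ at h5
    have h6 := hd x hx
    have hAU : (#A : ℝ) ≤ #U := by exact_mod_cast Finset.card_le_card hA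
    have h7 : (#N : ℝ) * #A ≤ #U / 200 * #U := by gcongr
    have h8 : ((1 / 2 - 20 * η) * #U) * ((1 / 2 - 20 * η) * #U) ≤ (#A : ℝ) * #A := by
      have : 0 ≤ (1 / 2 - 20 * η) * (#U : ℝ) := mul_nonneg (by linarith) hU
      gcongr
    have h9 : 0 ≤ (η - η ^ 2 / 4) * (#U : ℝ) ^ 2 := mul_nonneg (by nlinarith) (by positivity)
    have h10 : 0 ≤ η ^ 2 * (#U : ℝ) ^ 2 := by positivity
    nlinarith

/-- A Fano-free hypergraph of large minimum degree is nearly bipartite. -/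
theorem Free.exists_independent_parts (hH : H.Free fano) {U : Finset V} {η : ℝ}
    (hη : 0 < η) (hη1 : η ≤ 1 / 100000) (hm : 6 / η ^ 2 ≤ #U)
    (hd : ∀ x ∈ U, (3 / 4 - η ^ 2 / 4) * (#U : ℝ) ^ 2 ≤ H.linkDeg U x) :
    ∃ X Y : Finset V, Disjoint X Y ∧ (#U : ℝ) ≤ #X + #Y + 4200 * η * #U ∧
      (∀ x ∈ X, ∀ y ∈ X, ∀ z ∈ X, ¬ H.Triple x y z) ∧
      (∀ x ∈ Y, ∀ y ∈ Y, ∀ z ∈ Y, ¬ H.Triple x y z) := by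
  classical
  have hη2 : η ≤ 1 / 1000 := by linarith
  have hU : (0 : ℝ) < #U := lt_of_lt_of_le (by positivity) hm
  have hη3 : η ^ 2 ≤ 1 / 1000 := by nlinarith
  obtain ⟨s, hsU, hs⟩ := H.exists_isTetrahedron (U := U) (by
    have h1 : (#U : ℝ) * ((3 / 4 - η ^ 2 / 4) * (#U : ℝ) ^ 2) ≤ H.vol U := by
      calc _ = ∑ _x ∈ U, (3 / 4 - η ^ 2 / 4) * (#U : ℝ) ^ 2 := by simp
        _ ≤ _ := Finset.sum_le_sum hd
    have h2 : (0 : ℝ) < (#U : ℝ) ^ 3 := by positivity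
    nlinarith)
  obtain ⟨A, B, hA, hB, hAB, hAc, hBc, hABs⟩ := hH.exists_parts hs hη hη2 hm fun i => hd _ (hsU i)
  set p := s 0 with hp
  have hpU : p ∈ U := hsU 0
  wlog hpB : ∀ y ∈ B, ∀ z ∈ B, ¬ H.Triple p y z generalizing A B
  · exact this B A hB hA hAB.symm hBc hAc (fun i => (hABs i).symm) ((hABs 0).resolve_left hpB)
  have hmp := pairCount_missing_le hη hη2 hB hBc (hd p hpU) hpB
  -- The exceptional vertices. Markov's inequality applied to the at most `21 η |U|²` missing pairs
  -- gives the constant `4200 = 21 * 200`.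
  set E : Finset V := {x ∈ U | ¬ (#{y ∈ A | ¬ H.Triple p x y} : ℝ) ≤ #U / 200} with hE
  have hEc : (#E : ℝ) ≤ 4200 * η * #U := by
    have h1 : (#E : ℝ) * (#U / 200) ≤ 21 * η * (#U : ℝ) ^ 2 := by
      calc (#E : ℝ) * (#U / 200) = ∑ _x ∈ E, (#U / 200 : ℝ) := by simp
        _ ≤ ∑ x ∈ E, (#{y ∈ A | ¬ H.Triple p x y} : ℝ) := Finset.sum_le_sum fun x hx => by
            exact (not_le.1 (Finset.mem_filter.1 hx).2).le
        _ ≤ ∑ x ∈ U, (#{y ∈ A | ¬ H.Triple p x y} : ℝ) :=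
            Finset.sum_le_sum_of_subset_of_nonneg (Finset.filter_subset _ _)
              fun _ _ _ => Nat.cast_nonneg _
        _ = pairCount U (fun x y => y ∈ A ∧ ¬ H.Triple p x y) := by
            rw [pairCount_eq_sum_card]
            refine Finset.sum_congr rfl fun x _ => ?_
            congr 2
            ext y
            simp only [mem_filter]
            exact ⟨fun hh => ⟨hA hh.1, hh⟩, fun hh => hh.2⟩
        _ ≤ _ := le_trans (pairCount_mono fun x _ y _ h =>
            ⟨fun h' => Finset.disjoint_left.1 hAB h.1 h'.2, h.2⟩) hmp
    have h2 : ((#E : ℝ) - 4200 * η * #U) * #U ≤ 0 := by nlinarith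
    nlinarith
  obtain ⟨T, hT⟩ : ∃ T : V → Prop, ∀ x, T x ↔
      pairCount U (fun y z => H.Triple p y z ∧ ¬ H.Triple x y z) ≤ 21 * η * (#U : ℝ) ^ 2 :=
    ⟨_, fun _ => Iff.rfl⟩
  have hdich : ∀ x ∈ U \ E, ¬ T x →
      pairCount U (fun y z => (y ∈ B ∧ z ∈ B) ∧ ¬ H.Triple x y z) ≤
        (42 * η + 1 / 100) * (#U : ℝ) ^ 2 := by
    intro x hx hTx
    rw [Finset.mem_sdiff] at hx
    rw [hT] at hTx
    have hpx : (#{y ∈ A | ¬ H.Triple p x y} : ℝ) ≤ #U / 200 := by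
      by_contra hc
      exact hx.2 (Finset.mem_filter.2 ⟨hx.1, hc⟩)
    exact (hH.link_dichotomy hη hη2 hm hd hA hB hAB hAc hBc hpU hx.1 hpB hpx).resolve_left hTx
  have hU2 : 0 < (#U : ℝ) ^ 2 := by positivity
  refine ⟨{x ∈ U \ E | T x}, {x ∈ U \ E | ¬ T x}, Finset.disjoint_filter_filter_not _ _ _,
    ?_, ?_, ?_⟩
  · have h1 : #{x ∈ U \ E | T x} + #{x ∈ U \ E | ¬ T x} = #(U \ E) := by
      convert Finset.card_filter_add_card_filter_not (s := U \ E) T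
    have h2 := Finset.card_sdiff_add_card_eq_card (s := E) (t := U) (Finset.filter_subset _ _)
    have h3 : (#{x ∈ U \ E | T x} : ℝ) + #{x ∈ U \ E | ¬ T x} + #E = #U := by
      exact_mod_cast (by omega)
    linarith
  · intro x hx y hy z hz
    -- Each of the three links loses at most `21 η` from the link of `p`, so the common density
    -- stays above `2/3`.
    apply hH.not_triple_of_common_link (S := U)
    have hx' := (Finset.mem_filter.1 hx).2
    have hy' := (Finset.mem_filter.1 hy).2
    have hz' := (Finset.mem_filter.1 hz).2
    rw [hT] at hx' hy' hz'
    have h1 := pairCount_le_add (U := U) (P := H.Triple p)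
      (Q := fun a b => H.Triple x a b ∧ H.Triple y a b ∧ H.Triple z a b)
      (R := fun a b => (H.Triple p a b ∧ ¬ H.Triple x a b) ∨
        ((H.Triple p a b ∧ ¬ H.Triple y a b) ∨ (H.Triple p a b ∧ ¬ H.Triple z a b)))
      (fun a _ b _ h => by tauto)
    have h2 := pairCount_le_add (U := U) (P := fun a b => (H.Triple p a b ∧ ¬ H.Triple x a b) ∨
        ((H.Triple p a b ∧ ¬ H.Triple y a b) ∨ (H.Triple p a b ∧ ¬ H.Triple z a b)))
      (fun a _ b _ h => h)
    have h3 := pairCount_le_add (U := U) (P := fun a b =>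
        (H.Triple p a b ∧ ¬ H.Triple y a b) ∨ (H.Triple p a b ∧ ¬ H.Triple z a b))
      (fun a _ b _ h => h)
    have h4 := hd p hpU
    change H.linkDeg U p ≤ _ at h1
    nlinarith
  · intro x hx y hy z hz
    -- Here the losses are relative to all pairs of `B`: they total about `3/100` of `|U|²`, well
    -- below a third of `|B|² ≈ |U|² / 4`.
    apply hH.not_triple_of_common_link (S := B)
    have hx' := hdich x (Finset.mem_filter.1 hx).1 (Finset.mem_filter.1 hx).2
    have hy' := hdich y (Finset.mem_filter.1 hy).1 (Finset.mem_filter.1 hy).2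
    have hz' := hdich z (Finset.mem_filter.1 hz).1 (Finset.mem_filter.1 hz).2
    rw [pairCount_subset hB] at hx' hy' hz'
    have h1 := pairCount_le_add (U := B) (P := fun _ _ => True)
      (Q := fun a b => H.Triple x a b ∧ H.Triple y a b ∧ H.Triple z a b)
      (R := fun a b => ¬ H.Triple x a b ∨ (¬ H.Triple y a b ∨ ¬ H.Triple z a b))
      (fun a _ b _ h => by tauto)
    have h2 := pairCount_le_add (U := B) (P := fun a b => ¬ H.Triple x a b ∨
        (¬ H.Triple y a b ∨ ¬ H.Triple z a b)) (fun a _ b _ h => h)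
    have h3 := pairCount_le_add (U := B) (P := fun a b =>
        ¬ H.Triple y a b ∨ ¬ H.Triple z a b) (fun a _ b _ h => h)
    rw [pairCount_true] at h1
    have h4 : (49 / 100 * (#U : ℝ)) ^ 2 ≤ (#B : ℝ) ^ 2 := by
      have : 49 / 100 * (#U : ℝ) ≤ #B := by nlinarith
      gcongr
    nlinarith

/-! ### Passing to large minimum degree, and counting ordered triples -/

/-- A subset of large minimum degree, obtained by optimising. -/
theorem Free.exists_large_minDegree (hH : H.Free fano) (S : Finset V) {γ : ℝ} (hγ : 0 < γ)
    (hγ1 : γ ≤ 1 / 4) (hm : 6 / γ ^ 2 ≤ #S) (hS : (3 / 4 - γ ^ 2) * (#S : ℝ) ^ 3 ≤ H.vol S) :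
    ∃ U ⊆ S, (1 - 2 * γ) * #S ≤ #U ∧
      ∀ x ∈ U, (3 / 4 - 2 * γ) * (#U : ℝ) ^ 2 ≤ H.linkDeg U x := by
  obtain ⟨U, hUS, hmax⟩ := Finset.exists_max_image S.powerset
    (fun U => H.vol U - (3 / 4 - γ) * (#U : ℝ) ^ 3) ⟨S, by simp⟩
  rw [Finset.mem_powerset] at hUS
  have h1 := hmax S (by simp)
  have h2 := hH.vol_le U
  have hcard : (#U : ℝ) ≤ #S := by exact_mod_cast Finset.card_le_card hUS
  have hSpos : (0 : ℝ) < #S := lt_of_lt_of_le (by positivity) hm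
  have hm' : 6 ≤ #S * γ ^ 2 := by rwa [div_le_iff₀ (by positivity)] at hm
  have hU0 : (0 : ℝ) ≤ #U := Nat.cast_nonneg _
  have hU2 : (#U : ℝ) ^ 2 ≤ (#S : ℝ) ^ 2 := by gcongr
  have hbig : (1 - 2 * γ) * #S ≤ #U := by
    by_contra! hlt
    have h3 : (γ - γ ^ 2) * (#S : ℝ) ^ 3 ≤ γ * (#U : ℝ) ^ 3 + 9 / 2 * (#S : ℝ) ^ 2 := by
      linarith
    have h0 : 0 ≤ (1 - 2 * γ) * (#S : ℝ) := hU0.trans hlt.le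
    have h4 : (#U : ℝ) ^ 3 ≤ (1 - 2 * γ) * (#S : ℝ) ^ 3 := by
      calc (#U : ℝ) ^ 3 = #U * (#U : ℝ) ^ 2 := by ring
        _ ≤ ((1 - 2 * γ) * #S) * (#S : ℝ) ^ 2 := by gcongr
        _ = _ := by ring
    have h5 : γ * (#U : ℝ) ^ 3 ≤ γ * ((1 - 2 * γ) * (#S : ℝ) ^ 3) := by gcongr
    have h6 : 6 * (#S : ℝ) ^ 2 ≤ #S * γ ^ 2 * (#S : ℝ) ^ 2 := by gcongr
    have h7 : (0 : ℝ) < (#S : ℝ) ^ 2 := by positivity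
    nlinarith
  refine ⟨U, hUS, hbig, fun x hx => ?_⟩
  have h3 := hmax (U.erase x) (by
    rw [Finset.mem_powerset]
    exact (Finset.erase_subset _ _).trans hUS)
  have h4 := H.vol_erase hx
  have h5 : (#(U.erase x) : ℝ) = #U - 1 := by
    rw [Finset.card_erase_of_mem hx, Nat.cast_sub (Finset.card_pos.2 ⟨x, hx⟩)]
    simp
  simp only [h5] at h3
  have h6 : (3 / 4 - γ) * (3 * (#U : ℝ) ^ 2 - 3 * #U + 1) ≤ 3 * H.linkDeg U x := by
    linarith
  have h7 : 3 ≤ #U * γ := by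
    have : γ ^ 2 ≤ γ / 4 := by nlinarith
    have : (1 / 2 : ℝ) * #S ≤ #U := by nlinarith
    nlinarith
  have h8 : 3 * (#U : ℝ) ≤ #U * γ * #U := by gcongr
  nlinarith

theorem card_orderings {e : Finset V} [Fintype V] (he : #e = 3) :
    #{p : V × V × V | ({p.1, p.2.1, p.2.2} : Finset V) = e} = 6 := by
  obtain ⟨a, b, c, hab, hac, hbc, rfl⟩ := Finset.card_eq_three.1 he
  have : ({p : V × V × V | ({p.1, p.2.1, p.2.2} : Finset V) = {a, b, c}} : Finset (V × V × V)) =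
      {(a, b, c), (a, c, b), (b, a, c), (b, c, a), (c, a, b), (c, b, a)} := by
    ext ⟨x, y, z⟩
    simp only [mem_filter, mem_univ, true_and, mem_insert, mem_singleton, Prod.mk.injEq]
    constructor
    · intro h
      have hx : x ∈ ({a, b, c} : Finset V) := by rw [← h]; simp
      have hy : y ∈ ({a, b, c} : Finset V) := by rw [← h]; simp
      have hz : z ∈ ({a, b, c} : Finset V) := by rw [← h]; simp
      have ha : a ∈ ({x, y, z} : Finset V) := by rw [h]; simp
      have hb : b ∈ ({x, y, z} : Finset V) := by rw [h]; simp
      have hc : c ∈ ({x, y, z} : Finset V) := by rw [h]; simp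
      simp only [mem_insert, mem_singleton] at hx hy hz ha hb hc
      clear h he
      grind
    · rintro (⟨rfl, rfl, rfl⟩ | ⟨rfl, rfl, rfl⟩ | ⟨rfl, rfl, rfl⟩ | ⟨rfl, rfl, rfl⟩ |
        ⟨rfl, rfl, rfl⟩ | ⟨rfl, rfl, rfl⟩) <;> ext t <;> simp only [mem_insert, mem_singleton] <;>
        tauto
  rw [this]
  simp [hab, hac, hbc, hab.symm, hac.symm, hbc.symm]

theorem vol_univ [Fintype V] (H : UniformHypergraph 3 V) :
    H.vol univ = 6 * (#H.edges : ℝ) := by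
  have h1 : H.vol univ = #{p : V × V × V | H.Triple p.1 p.2.1 p.2.2} := by
    rw [vol, Finset.card_filter, Fintype.sum_prod_type]
    push_cast
    refine Finset.sum_congr rfl fun x _ => ?_
    rw [linkDeg_eq_sum, Fintype.sum_prod_type]
  have h2 := Finset.card_eq_sum_card_fiberwise
    (s := ({p : V × V × V | H.Triple p.1 p.2.1 p.2.2} : Finset (V × V × V)))
    (f := fun p : V × V × V => ({p.1, p.2.1, p.2.2} : Finset V)) (t := H.edges)
    (fun p hp => (Finset.mem_filter.1 (Finset.mem_coe.1 hp)).2)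
  have h3 : ∀ e ∈ H.edges, #{p ∈ ({p : V × V × V | H.Triple p.1 p.2.1 p.2.2} :
      Finset (V × V × V)) | ({p.1, p.2.1, p.2.2} : Finset V) = e} = 6 := fun e he => by
    rw [← card_orderings (H.uniform e he), Finset.filter_filter]
    congr 1
    ext p
    simp only [mem_filter, mem_univ, true_and, and_iff_right_iff_imp]
    rintro rfl
    exact he
  rw [h1, h2, Finset.sum_congr rfl h3]
  simp [mul_comm]

theorem vol_le_cube (H : UniformHypergraph 3 V) (U : Finset V) : H.vol U ≤ (#U : ℝ) ^ 3 := by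
  calc H.vol U ≤ ∑ _x ∈ U, (#U : ℝ) ^ 2 := Finset.sum_le_sum fun x _ => by
        rw [← pairCount_true]
        exact pairCount_mono fun _ _ _ _ _ => trivial
    _ = (#U : ℝ) ^ 3 := by simp; ring

/-! ### The bipartite construction and the lower bound for the Turán number -/

/-- The complete bipartite `3`-uniform hypergraph: all triples that are not monochromatic. -/
def bipartite [Fintype V] (χ : V → Bool) : UniformHypergraph 3 V where
  edges := {e ∈ Finset.powersetCard 3 univ | ¬ ∃ c, ∀ x ∈ e, χ x = c}
  uniform _ he := (Finset.mem_powersetCard.1 (Finset.mem_filter.1 he).1).2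

set_option maxRecDepth 100000 in
theorem fano_not_two_colourable :
    ∀ g : Fin 7 → Bool, ∃ e ∈ fano.edges, ∃ c, ∀ x ∈ e, g x = c := by
  decide +kernel

theorem bipartite_free [Fintype V] (χ : V → Bool) : (bipartite χ).Free fano := by
  rintro ⟨f, hf⟩
  obtain ⟨e, he, c, hc⟩ := fano_not_two_colourable fun i => χ (f i)
  refine (Finset.mem_filter.1 (hf e he)).2 ⟨c, fun x hx => ?_⟩
  obtain ⟨i, hi, rfl⟩ := Finset.mem_map.1 hx
  exact hc i hi

theorem bipartite_triple [Fintype V] {χ : V → Bool} {x y z : V} (hxy : x ≠ y) (hxz : x ≠ z)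
    (hyz : y ≠ z) (h : ¬ (χ y = χ x ∧ χ z = χ x)) : (bipartite χ).Triple x y z := by
  refine Finset.mem_filter.2 ⟨Finset.mem_powersetCard.2 ⟨Finset.subset_univ _, ?_⟩, ?_⟩
  · exact Finset.card_eq_three.2 ⟨x, y, z, hxy, hxz, hyz, rfl⟩
  · rintro ⟨c, hc⟩
    have h1 := hc x (by simp)
    have h2 := hc y (by simp)
    have h3 := hc z (by simp)
    exact h ⟨h2.trans h1.symm, h3.trans h1.symm⟩

/-- A pair is missing from the link of `x` only if both ends share its colour or one of the
coincidences `y = x`, `z = x`, `y = z` occurs; these account for the term `3 * Fintype.card V`. -/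
theorem linkDeg_bipartite [Fintype V] (χ : V → Bool) (x : V) :
    (Fintype.card V : ℝ) ^ 2 - 3 * Fintype.card V - (#{y | χ y = χ x} : ℝ) ^ 2 ≤
      (bipartite χ).linkDeg univ x := by
  classical
  set D : Finset V := {y | χ y = χ x} with hD
  have h1 := pairCount_le_add (U := (univ : Finset V)) (P := fun _ _ => True)
    (Q := (bipartite χ).Triple x)
    (R := fun y z => (y ∈ D ∧ z ∈ D) ∨ ((y ∈ ({x} : Finset V) ∧ z ∈ univ) ∨
      ((y ∈ univ ∧ z ∈ ({x} : Finset V)) ∨ y = z)))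
    (fun y _ z _ _ => by
      by_contra hc
      simp only [mem_singleton, mem_univ, true_and, and_true, not_or] at hc
      obtain ⟨h0, h1, h2, h3, h4⟩ := hc
      refine h0 (bipartite_triple (Ne.symm h2) (Ne.symm h3) h4 fun h => ?_)
      exact h1 ⟨by simp [hD, h.1], by simp [hD, h.2]⟩)
  have h2 := pairCount_le_add (U := (univ : Finset V))
    (P := fun y z => (y ∈ D ∧ z ∈ D) ∨ ((y ∈ ({x} : Finset V) ∧ z ∈ univ) ∨
      ((y ∈ univ ∧ z ∈ ({x} : Finset V)) ∨ y = z))) (fun _ _ _ _ h => h)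
  have h3 := pairCount_le_add (U := (univ : Finset V))
    (P := fun y z => (y ∈ ({x} : Finset V) ∧ z ∈ univ) ∨
      ((y ∈ univ ∧ z ∈ ({x} : Finset V)) ∨ y = z)) (fun _ _ _ _ h => h)
  have h4 := pairCount_le_add (U := (univ : Finset V))
    (P := fun y z => (y ∈ univ ∧ z ∈ ({x} : Finset V)) ∨ y = z) (fun _ _ _ _ h => h)
  have h5 : pairCount (univ : Finset V) (fun y z => y = z) = Fintype.card V := by
    rw [pairCount_eq_sum]
    refine (Finset.sum_congr rfl fun y _ => (?_ : _ = (1 : ℝ))).trans (by simp)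
    exact (Finset.sum_eq_single y (fun z _ hz => if_neg (Ne.symm hz))
      fun h => absurd (mem_univ y) h).trans (if_pos rfl)
  rw [pairCount_true] at h1
  rw [pairCount_mem_mem (subset_univ _) (subset_univ _)] at h2 h3 h4
  simp only [card_univ, card_singleton, Nat.cast_one] at h1 h2 h3 h4
  change _ ≤ (bipartite χ).linkDeg univ x + _ at h1
  linarith

theorem le_ex {n : ℕ} {H : UniformHypergraph 3 (Fin n)} (hH : H.Free fano) :
    #H.edges ≤ ex n fano := by
  refine le_csSup ⟨Fintype.card (Finset (Fin n)), ?_⟩ ⟨H, hH, rfl⟩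
  rintro m ⟨K, -, rfl⟩
  exact Finset.card_le_univ _

theorem ex_lower_bound (n : ℕ) :
    3 / 4 * (n : ℝ) ^ 3 - 4 * (n : ℝ) ^ 2 ≤ 6 * (ex n fano : ℝ) := by
  rcases n.eq_zero_or_pos with rfl | hn
  · simp
  set χ : Fin n → Bool := fun x => decide ((x : ℕ) < n / 2) with hχ
  have hlt : #{y : Fin n | (y : ℕ) < n / 2} = n / 2 := by
    rw [Fin.card_filter_val_lt]
    omega
  have hclass : ∀ x, (#{y | χ y = χ x} : ℝ) ≤ ((n : ℝ) + 1) / 2 := by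
    intro x
    have h1 : 2 * #{y | χ y = χ x} ≤ n + 1 := by
      by_cases hx : (x : ℕ) < n / 2
      · have : univ.filter (fun y => χ y = χ x) = univ.filter fun y : Fin n => (y : ℕ) < n / 2 := by
          ext y; simp [hχ, hx]
        rw [this, hlt]
        omega
      · have h2 : univ.filter (fun y => χ y = χ x) = univ.filter fun y : Fin n => ¬ (y : ℕ) < n / 2 := by
          ext y; simp [hχ, hx]
        have h3 := Finset.card_filter_add_card_filter_not (s := (univ : Finset (Fin n)))
          (fun y => (y : ℕ) < n / 2)
        rw [hlt, Finset.card_univ, Fintype.card_fin] at h3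
        rw [h2]
        omega
    have h2 : (2 : ℝ) * #{y | χ y = χ x} ≤ n + 1 := by exact_mod_cast h1
    linarith
  have h1 : (#(bipartite χ).edges : ℝ) ≤ ex n fano := by exact_mod_cast le_ex (bipartite_free χ)
  have h2 := (bipartite χ).vol_univ
  have hn1 : (1 : ℝ) ≤ n := by exact_mod_cast hn
  have h3 : (n : ℝ) * ((n : ℝ) ^ 2 - 3 * n - (((n : ℝ) + 1) / 2) ^ 2) ≤ (bipartite χ).vol univ := by
    calc _ = ∑ _x : Fin n, ((n : ℝ) ^ 2 - 3 * n - (((n : ℝ) + 1) / 2) ^ 2) := by simp; ring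
      _ ≤ _ := Finset.sum_le_sum fun x _ => by
        have h4 := linkDeg_bipartite χ x
        rw [Fintype.card_fin] at h4
        have h5 : (#{y | χ y = χ x} : ℝ) ^ 2 ≤ (((n : ℝ) + 1) / 2) ^ 2 := by
          have := hclass x
          gcongr
        linarith
  nlinarith

/-! ### Stability and the final constants -/

/-- If `X` and `Y` span no hyperedges, then few hyperedges lie inside `Y` or its complement. -/
theorem edgesIn_add_edgesIn_le [Fintype V] (H : UniformHypergraph 3 V) {X Y : Finset V}
    (hXY : Disjoint X Y) (hX : ∀ x ∈ X, ∀ y ∈ X, ∀ z ∈ X, ¬ H.Triple x y z)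
    (hY : ∀ x ∈ Y, ∀ y ∈ Y, ∀ z ∈ Y, ¬ H.Triple x y z) :
    (H.edgesIn Yᶜ : ℝ) + H.edgesIn Y ≤
      ((Fintype.card V : ℝ) - #X - #Y) * (Fintype.card V : ℝ) ^ 2 := by
  have hY0 : H.edgesIn Y = 0 := by
    rw [edgesIn, Finset.card_eq_zero, Finset.filter_eq_empty_iff]
    intro e he heY
    obtain ⟨a, b, c, -, -, -, rfl⟩ := Finset.card_eq_three.1 (H.uniform e he)
    exact hY a (heY (by simp)) b (heY (by simp)) c (heY (by simp)) he
  have hc : H.edgesIn Yᶜ ≤ #((X ∪ Y)ᶜ ×ˢ ((univ : Finset V) ×ˢ (univ : Finset V))) := by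
    refine le_trans (Finset.card_le_card ?_)
      (Finset.card_image_le (f := fun p : V × V × V => ({p.1, p.2.1, p.2.2} : Finset V)))
    intro e he
    obtain ⟨he, heY⟩ := Finset.mem_filter.1 he
    have hr : ∃ r ∈ e, r ∉ X := by
      by_contra! hall
      obtain ⟨a, b, c, -, -, -, rfl⟩ := Finset.card_eq_three.1 (H.uniform e he)
      exact hX a (hall a (by simp)) b (hall b (by simp)) c (hall c (by simp)) he
    -- A hyperedge avoiding `Y` has a vertex `r` outside `X ∪ Y`; listing `r` first embeds it in the
    -- product being counted.
    obtain ⟨r, hre, hrX⟩ := hr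
    have h2 : #(e.erase r) = 2 := by rw [Finset.card_erase_of_mem hre, H.uniform e he]
    obtain ⟨b, c, -, hbc⟩ := Finset.card_eq_two.1 h2
    refine Finset.mem_image.2 ⟨(r, b, c), ?_, ?_⟩
    · have := Finset.mem_compl.1 (heY hre)
      simp [hrX, this]
    · simp only
      rw [← hbc, Finset.insert_erase hre]
  have hcard : (#((X ∪ Y)ᶜ) : ℝ) = (Fintype.card V : ℝ) - #X - #Y := by
    rw [Finset.card_compl, Nat.cast_sub (Finset.card_le_univ _),
      Finset.card_union_of_disjoint hXY]
    push_cast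
    ring
  rw [Finset.card_product, Finset.card_product, Finset.card_univ] at hc
  rw [hY0, ← hcard]
  have : (H.edgesIn Yᶜ : ℝ) ≤ (#((X ∪ Y)ᶜ) * (Fintype.card V * Fintype.card V) : ℕ) := by
    exact_mod_cast hc
  push_cast at this ⊢
  linarith

/-- Fano-free hypergraphs with almost `n ^ 3 / 8` hyperedges are nearly bipartite. -/
theorem Free.stability [Fintype V] {H : UniformHypergraph 3 V} (hH : H.Free fano) {θ : ℝ}
    (hθ : 0 < θ) (hθ1 : θ ≤ 1 / 11) (hn : 16 / θ ^ 64 ≤ Fintype.card V)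
    (he : (ex (Fintype.card V) fano : ℝ) - θ ^ 64 * (Fintype.card V : ℝ) ^ 3 / 8 ≤ #H.edges) :
    ∃ Y : Finset V, (H.edgesIn Yᶜ : ℝ) + H.edgesIn Y ≤ θ * (Fintype.card V : ℝ) ^ 3 := by
  set n : ℝ := (Fintype.card V : ℝ) with hn'
  have hnpos : 0 < n := lt_of_lt_of_le (by positivity) hn
  have hγ : θ ^ 32 ≤ 1 / 16 * θ ^ 16 := by
    have : θ ^ 16 ≤ (1 / 11) ^ 16 := by gcongr
    have h2 : θ ^ 32 = θ ^ 16 * θ ^ 16 := by ring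
    rw [h2]
    gcongr
    exact this.trans (by norm_num)
  have hη : θ ^ 8 ≤ 1 / 10000000 * θ := by
    have : θ ^ 7 ≤ (1 / 11) ^ 7 := by gcongr
    have h2 : θ ^ 8 = θ ^ 7 * θ := by ring
    rw [h2]
    gcongr
    exact this.trans (by norm_num)
  have hγθ : θ ^ 32 ≤ 1 / 16 * θ := by
    have : θ ^ 16 ≤ θ ^ 1 := pow_le_pow_of_le_one hθ.le (by linarith) (by norm_num)
    linarith
  have hθ16 : 0 < θ ^ 16 := by positivity
  have h64 : (θ ^ 32) ^ 2 = θ ^ 64 := by ring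
  have h16 : (θ ^ 8) ^ 2 = θ ^ 16 := by ring
  have hn64 : 16 ≤ n * θ ^ 64 := by rwa [div_le_iff₀ (by positivity)] at hn
  have hvol : (3 / 4 - (θ ^ 32) ^ 2) * n ^ 3 ≤ H.vol univ := by
    have h1 := ex_lower_bound (Fintype.card V)
    rw [vol_univ, h64]
    have h2 : 16 * n ^ 2 ≤ n * θ ^ 64 * n ^ 2 := by gcongr
    nlinarith
  -- The exponents come from two square-root losses: `γ² = θ ^ 64` here, and `2 γ ≤ η² / 4` with `η
  -- = θ ^ 8` below. The spare powers of `θ ≤ 1 / 11` absorb the factor 4200.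
  obtain ⟨U, -, hUc, hUd⟩ := hH.exists_large_minDegree univ (γ := θ ^ 32) (by positivity)
    (by linarith) (by
      rw [h64, Finset.card_univ]
      refine le_trans ?_ hn
      gcongr
      norm_num) (by rwa [Finset.card_univ])
  rw [Finset.card_univ] at hUc
  have hUn : (#U : ℝ) ≤ n := by rw [hn']; exact_mod_cast Finset.card_le_univ U
  have hUhalf : n / 2 ≤ #U := by nlinarith
  obtain ⟨X, Y, hXY, hc, hX, hY⟩ := hH.exists_independent_parts (U := U) (η := θ ^ 8)
    (by positivity) (by linarith) (by
      rw [h16, div_le_iff₀ (by positivity)]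
      have h1 : θ ^ 64 ≤ θ ^ 16 := pow_le_pow_of_le_one hθ.le (by linarith) (by norm_num)
      have h2 : n * θ ^ 64 ≤ n * θ ^ 16 := by gcongr
      have h3 : n / 2 * θ ^ 16 ≤ #U * θ ^ 16 := by gcongr
      linarith)
    (fun x hx => le_trans (by
      rw [h16]
      gcongr
      linarith) (hUd x hx))
  refine ⟨Y, (H.edgesIn_add_edgesIn_le hXY hX hY).trans ?_⟩
  have h1 : n - #X - #Y ≤ θ * n := by
    have h2 : θ ^ 8 * #U ≤ 1 / 10000000 * θ * n := by gcongr
    have h3 : θ ^ 32 * n ≤ 1 / 16 * θ * n := by gcongr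
    have h4 : 0 < θ * n := by positivity
    linarith
  calc (n - #X - #Y) * n ^ 2 ≤ θ * n * n ^ 2 := by gcongr
    _ = θ * n ^ 3 := by ring

end UniformHypergraph

theorem theorem1p2 (δ : ℝ) (hδ : 0 < δ) (hδ' : δ < (1 / 36 : ℝ) ^ 8) :
    ∃ n₀ : ℕ, ∀ n : ℕ, n₀ ≤ n →
      ∀ (V : Type*) [Fintype V] [DecidableEq V] (H : UniformHypergraph 3 V),
        Fintype.card V = n →
        H.Free UniformHypergraph.fano →
        (UniformHypergraph.ex n UniformHypergraph.fano : ℝ) - δ * (n : ℝ) ^ 3 / 8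
          ≤ (H.edges.card : ℝ) →
        ∃ A B : Finset V, A ∪ B = Finset.univ ∧ Disjoint A B ∧
          (H.edgesIn A : ℝ) + (H.edgesIn B : ℝ)
            ≤ 9 / 16 * (3 ^ 2 * 2 ^ 4 * 139 : ℝ) ^ (1 / 8 : ℝ) * δ ^ (1 / 64 : ℝ) * (n : ℝ) ^ 3 ∧
          9 / 16 * (3 ^ 2 * 2 ^ 4 * 139 : ℝ) ^ (1 / 8 : ℝ) * δ ^ (1 / 64 : ℝ) * (n : ℝ) ^ 3
            < 1.94 * δ ^ (1 / 64 : ℝ) * (n : ℝ) ^ 3 := by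
  set θ : ℝ := δ ^ (1 / 64 : ℝ) with hθ
  set c : ℝ := (3 ^ 2 * 2 ^ 4 * 139 : ℝ) ^ (1 / 8 : ℝ) with hc
  have hθ0 : 0 < θ := Real.rpow_pos_of_pos hδ _
  have hθ64 : θ ^ 64 = δ := by
    rw [hθ, ← Real.rpow_natCast, ← Real.rpow_mul hδ.le]
    norm_num
  have hc0 : 0 < c := Real.rpow_pos_of_pos (by norm_num) _
  have hc8 : c ^ 8 = 20016 := by
    rw [hc, ← Real.rpow_natCast, ← Real.rpow_mul (by norm_num)]
    norm_num
  have hc1 : c < 1.94 * 16 / 9 :=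
    lt_of_pow_lt_pow_left₀ 8 (by norm_num) (by rw [hc8]; norm_num)
  have hc2 : 1.9 * 16 / 9 < c :=
    lt_of_pow_lt_pow_left₀ 8 hc0.le (by rw [hc8]; norm_num)
  refine ⟨⌈16 / δ⌉₊, fun n hn V _ _ H hV hH he => ?_⟩
  have hn16 : 16 / δ ≤ n := (Nat.le_ceil _).trans (by exact_mod_cast hn)
  have hnpos : (0 : ℝ) < n := lt_of_lt_of_le (by positivity) hn16
  have hpos : 0 < θ * (n : ℝ) ^ 3 := by positivity
  have hlast : 9 / 16 * c * θ * (n : ℝ) ^ 3 < 1.94 * θ * (n : ℝ) ^ 3 := by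
    rw [mul_assoc, mul_assoc (1.94 : ℝ)]
    exact mul_lt_mul_of_pos_right (by linarith) hpos
  have hfirst : 1.9 * (θ * (n : ℝ) ^ 3) ≤ 9 / 16 * c * θ * (n : ℝ) ^ 3 := by
    rw [mul_assoc (9 / 16 * c)]
    exact mul_le_mul_of_nonneg_right (by linarith) hpos.le
  -- For `θ > 1 / 11` the claim is trivial: there are at most `n ^ 3 / 6` hyperedges, and `1.9 / 11
  -- > 1 / 6`.
  rcases le_or_gt θ (1 / 11) with hsmall | hlarge
  · subst hV
    rw [← hθ64] at he hn16
    obtain ⟨Y, hY⟩ := hH.stability hθ0 hsmall hn16 he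
    exact ⟨Yᶜ, Y, by rw [union_comm, union_compl], disjoint_compl_left, by linarith, hlast⟩
  · refine ⟨univ, ∅, by simp, by simp, ?_, hlast⟩
    have h1 : H.edgesIn univ ≤ #H.edges := Finset.card_le_card (Finset.filter_subset _ _)
    have h2 : H.edgesIn ∅ = 0 := by
      rw [UniformHypergraph.edgesIn, Finset.card_eq_zero, Finset.filter_eq_empty_iff]
      intro e hee hsub
      have := H.uniform e hee
      rw [Finset.subset_empty.1 hsub] at this
      simp at this
    have h3 := H.vol_univ
    have h4 := H.vol_le_cube univ
    rw [Finset.card_univ, hV] at h4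
    have h5 : (H.edgesIn univ : ℝ) ≤ #H.edges := by exact_mod_cast h1
    have h6 : 1 / 11 * (n : ℝ) ^ 3 ≤ θ * (n : ℝ) ^ 3 := by gcongr
    rw [h2]
    push_cast
    linarith
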